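/- Fix integers $r\ge 1$ and $K\ge 1$, a power $P>0$ and a variance $0<\tau\le 1$. Let $\mathbf h_1,\dots,\mathbf h_K\in\mathbb C^r$ be random vectors all of whose entries are independent, each with independent real and imaginary parts distributed as $N(0,\tau)$. For a threshold $u\in\mathbb R$ let $\mathcal S=\{i:\|\mathbf h_i\|^2>u\}$ be the set of transmitting users (Algorithm Channel-Access). For $i\in\mathcal S$ let $\mathbf H_{(-i)}$ be the matrix with columns $\mathbf h_s$, $s\in\mathcal S\setminus\{i\}$, and put $$\mathbf R_i=\bigl(\mathbf H_{(-i)}\mathbf H_{(-i)}^\dagger+I\bigr)^{-1}.$$ The sum capacity of a slot under MMSE decoding is $$C(u)=\sum_{i\in\mathcal S}\log\bigl(1+P\,\mathbf h_i^\dagger\mathbf R_i\mathbf h_i\bigr)\ \text{ if } |\mathcal S|\le r,\qquad C(u)=0\ \text{ if } |\mathcal S|>r .$$ Let $Q(r,x)=\Gamma(r)^{-1}\int_x^\infty t^{r-1}e^{-t}\,dt$ for $x\ge 0$, let $Q^{-1}(r,\cdot)$ be its inverse with respect to $x$, and let $$a_{\{K,r\}}=\tfrac{2}{K}\,\Gamma(r)\,\exp\bigl\{Q^{-1}(r,\tfrac1K)\bigr\}\,Q^{-1}(r,\tfrac1K)^{1-r}.$$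 Lemma. For all $r\ge1$, $P>0$, $0<\tau\le1$ and every real $\kappa$ there is $K_0$ such that for all $K\ge K_0$ and all real $k$ with $0<k\le\kappa$ the following holds. If $u_k$ is a threshold that $k$ of the $K$ users exceed on average, i.e. $\mathrm E|\{i:\|\mathbf h_i\|^2>u_k\}|=k$, then, with $a=a_{\{K,r\}}$, the random variable $C(u_k)$ is integrable and $$\mathrm E[C(u_k)]\le\sum_{j=1}^{r}\frac{k^je^{-k}}{j!}\,j\,\log\left(1+P\left(1-\frac{(j-1)u_k^2}{r\left((1+\frac jr)(u_k+a)^2+a(a+1)+u_k\right)}\right)(u_k+a)\right).$$ -/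

import Mathlib

open scoped NNReal Nat Matrix

noncomputable section

/-- The upper incomplete Gamma function `Γ(s, x) = ∫_x^∞ t^(s-1) e^(-t) dt`. -/
def upperGamma (s x : ℝ) : ℝ :=
  ∫ t in Set.Ioi x, t ^ (s - 1) * Real.exp (-t)

/-- The regularized upper incomplete Gamma function `Q(s, x) = Γ(s, x) / Γ(s)`. -/
def regGammaQ (s x : ℝ) : ℝ :=
  upperGamma s x / Real.Gamma s

/-- The inverse of `x ↦ Q(s, x)` on `[0, ∞)`: for `s > 0` and `0 < y ≤ 1` this is the unique
`x ≥ 0` with `Q(s, x) = y`. -/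
def regGammaQInv (s y : ℝ) : ℝ :=
  Function.invFunOn (regGammaQ s) (Set.Ici 0) y

/-- The normalizing constant
`a_{n,r} = (2 / n) Γ(r) exp(Q⁻¹(r, 1/n)) Q⁻¹(r, 1/n)^(1 - r)`. -/
def normConstA (n r : ℕ) : ℝ :=
  2 / (n : ℝ) * Real.Gamma (r : ℝ) * Real.exp (regGammaQInv (r : ℝ) (1 / (n : ℝ)))
    * regGammaQInv (r : ℝ) (1 / (n : ℝ)) ^ (1 - (r : ℝ))

/-- The law on `ℂ` of `a + i b` with `a`, `b` independent, centred Gaussian of variance `τ`. -/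
def complexGaussian (τ : ℝ≥0) : MeasureTheory.Measure ℂ :=
  ((ProbabilityTheory.gaussianReal 0 τ).prod (ProbabilityTheory.gaussianReal 0 τ)).map
    (fun z : ℝ × ℝ => (⟨z.1, z.2⟩ : ℂ))

/-- The law of the channel vectors of `K` users at a base station with `r` antennas: all entries
of all vectors are independent with law `complexGaussian τ`; `h i n` is the `n`-th entry of the
channel vector of user `i`. -/
def channelLaw (K r : ℕ) (τ : ℝ≥0) : MeasureTheory.Measure (Fin K → Fin r → ℂ) :=
  MeasureTheory.Measure.pi fun _ => MeasureTheory.Measure.pi fun _ => complexGaussian τ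

/-- The squared Euclidean norm of a channel vector. -/
def channelGain {r : ℕ} (v : Fin r → ℂ) : ℝ :=
  ∑ n, ‖v n‖ ^ 2

/-- The users that transmit under the channel-access algorithm with threshold `u`: those whose
squared channel norm exceeds `u`. -/
def transmitters {K r : ℕ} (u : ℝ) (h : Fin K → Fin r → ℂ) : Finset (Fin K) :=
  Finset.univ.filter fun i => u < channelGain (h i)

/-- The matrix whose columns are the channel vectors of the users in `T`. -/
def channelMatrix {K r : ℕ} (T : Finset (Fin K)) (h : Fin K → Fin r → ℂ) :
    Matrix (Fin r) T ℂ :=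
  Matrix.of fun n s => h s n

/-- The matrix `R = (H₍₋ᵢ₎ H₍₋ᵢ₎ᴴ + I)⁻¹`, where `H₍₋ᵢ₎` has as columns the channel vectors of
the users in `S` other than `i`. -/
def mmseMatrix {K r : ℕ} (S : Finset (Fin K)) (h : Fin K → Fin r → ℂ) (i : Fin K) :
    Matrix (Fin r) (Fin r) ℂ :=
  (channelMatrix (S.erase i) h * (channelMatrix (S.erase i) h)ᴴ + 1)⁻¹

/-- `SINRᵢ = hᵢᴴ R hᵢ`, which is real because `R` is Hermitian. -/
def mmseSINR {K r : ℕ} (S : Finset (Fin K)) (h : Fin K → Fin r → ℂ) (i : Fin K) : ℝ :=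
  (star (h i) ⬝ᵥ (mmseMatrix S h i *ᵥ h i)).re

/-- The sum capacity of one slot of the channel-access algorithm with MMSE decoding, power `P` and
threshold `u`: the sum of `log (1 + P * SINRᵢ)` over the transmitting users, and zero if more than
`r` users transmit (a collision). An idle slot gives the empty sum. -/
def sumCapacity {K r : ℕ} (P u : ℝ) (h : Fin K → Fin r → ℂ) : ℝ :=
  if (transmitters u h).card ≤ r then
    ∑ i ∈ transmitters u h, Real.log (1 + P * mmseSINR (transmitters u h) h i)
  else 0

/-- The expected sum capacity of the channel-access algorithm with MMSE decoding. -/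
def expectedSumCapacity (K r : ℕ) (τ : ℝ≥0) (P u : ℝ) : ℝ :=
  ∫ h, sumCapacity P u h ∂(channelLaw K r τ)

/-- The average number of users whose squared channel norm exceeds `u`. -/
def meanExceedances (K r : ℕ) (τ : ℝ≥0) (u : ℝ) : ℝ :=
  ∫ h, ((transmitters u h).card : ℝ) ∂(channelLaw K r τ)

/-- The `j`-th SNR term
`P (1 - (j-1) u² / (r ((1 + j/r)(u+a)² + a(a+1) + u))) (u + a)` of the capacity bound. -/
def mmseBoundSNR (r j : ℕ) (P u a : ℝ) : ℝ :=
  P * (1 - ((j : ℝ) - 1) * u ^ 2 /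
    ((r : ℝ) * ((1 + (j : ℝ) / (r : ℝ)) * (u + a) ^ 2 + a * (a + 1) + u))) * (u + a)

end

open MeasureTheory ProbabilityTheory Filter Topology ComplexConjugate

/-! Write u = 2τx, so that a user transmits with probability p = Q(r, x) = k/K. The users are
independent, so given that the transmitters form a set T of size j, their vectors are independent
with the law of one vector conditioned on its gain exceeding u. Hence E[C(u)] is a sum over j ≤ r of
binomial probabilities times j times the mean rate of one transmitter. A binomial probability is at
most the Poisson one times exp(jp) (`choose_mul_pow_mul_exp_le`), so it suffices that the mean rate
is at most exp(-jp) times the logarithm in the bound, for all large x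
(`eventually_transmitter_rate_le`). Since p decays faster than any power of x, the factor exp(-jp)
costs almost nothing.

For j ≥ 2 there is room already at leading order. The MMSE form is the minimum of a regularized
least-squares problem, so a multiple of the matched filter as trial vector bounds the SINR by a
polynomial in the vectors. Isotropy makes the mean of this polynomial explicit, and Jensen's
inequality bounds the rate by log(1 + Pdu) with d < 1 - (j-1)/(r+j), whereas the SNR in the bound is
at least P(1 - (j-1)/(r+j))u. The logarithms differ by a positive constant in the limit, which
absorbs exp(-jp).

For j = 1 the leading terms agree, and for τ = 1 so do the first-order ones: the mean excess of the
gain over u is about 2τ, and a is about 2. The comparison is made at order x⁻². There a is twice the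
inverse hazard rate of the Gamma law at the quantile q with Q(r, q) = 1/K; since Q(r, x) ≤ κ Q(r,
q), x is not far below q, and a/2 loses at most 1/(8x) against its expansion at x. The variance of
the excess, which Jensen's inequality would discard, gains 1/(2x²) in the logarithm, so 1/2 - 1/8 =
3/8 remains. -/

/-! ### Gaussian channel vectors and the law of their squared norm -/

/-- The density of `complexGaussian τ`. -/
noncomputable def complexGaussianPDF (τ : ℝ≥0) (z : ℂ) : ℝ :=
  (2 * Real.pi * τ)⁻¹ * Real.exp (-‖z‖ ^ 2 / (2 * τ))

lemma complexGaussianPDF_nonneg (τ : ℝ≥0) (z : ℂ) : 0 ≤ complexGaussianPDF τ z := by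
  unfold complexGaussianPDF; positivity

lemma continuous_complexGaussianPDF (τ : ℝ≥0) : Continuous (complexGaussianPDF τ) := by
  unfold complexGaussianPDF; fun_prop

lemma gaussianPDFReal_mul_gaussianPDFReal (τ : ℝ≥0) (z : ℂ) :
    gaussianPDFReal 0 τ z.re * gaussianPDFReal 0 τ z.im = complexGaussianPDF τ z := by
  have h : (√(2 * Real.pi * τ)) * √(2 * Real.pi * τ) = 2 * Real.pi * τ :=
    Real.mul_self_sqrt (by positivity)
  rw [gaussianPDFReal, gaussianPDFReal, complexGaussianPDF, mul_mul_mul_comm, ← mul_inv, h,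
    ← Real.exp_add, ← Complex.normSq_eq_norm_sq, Complex.normSq_apply]
  congr 2
  ring

lemma complexGaussian_eq_withDensity {τ : ℝ≥0} (hτ : τ ≠ 0) :
    complexGaussian τ =
      volume.withDensity fun z => ENNReal.ofReal (complexGaussianPDF τ z) := by
  have hmeas : Measurable (fun z : ℝ × ℝ => (⟨z.1, z.2⟩ : ℂ)) :=
    Complex.measurableEquivRealProd.symm.measurable
  have hmp : MeasurePreserving (fun z : ℝ × ℝ => (⟨z.1, z.2⟩ : ℂ)) volume volume :=
    Complex.volume_preserving_equiv_real_prod.symm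
  ext s hs
  rw [complexGaussian, Measure.map_apply hmeas hs, gaussianReal_of_var_ne_zero _ hτ,
    prod_withDensity (measurable_gaussianPDF _ _) (measurable_gaussianPDF _ _),
    withDensity_apply _ (hmeas hs), withDensity_apply _ hs,
    ← hmp.setLIntegral_comp_preimage hs
      (continuous_complexGaussianPDF τ).measurable.ennreal_ofReal]
  refine lintegral_congr fun z => ?_
  rw [gaussianPDF, gaussianPDF, ← ENNReal.ofReal_mul (gaussianPDFReal_nonneg _ _ _),
    ← gaussianPDFReal_mul_gaussianPDFReal τ ⟨z.1, z.2⟩]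

instance (τ : ℝ≥0) : IsProbabilityMeasure (complexGaussian τ) := by
  unfold complexGaussian
  exact Measure.isProbabilityMeasure_map
    Complex.measurableEquivRealProd.symm.measurable.aemeasurable

lemma integrable_complexGaussianPDF {τ : ℝ≥0} (hτ : τ ≠ 0) :
    Integrable (complexGaussianPDF τ) := by
  refine ⟨(continuous_complexGaussianPDF τ).aestronglyMeasurable, ?_⟩
  rw [hasFiniteIntegral_iff_ofReal (.of_forall (complexGaussianPDF_nonneg τ))]
  have h := measure_lt_top (complexGaussian τ) Set.univ
  rwa [complexGaussian_eq_withDensity hτ, withDensity_apply _ MeasurableSet.univ,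
    Measure.restrict_univ] at h

/-- The law of the channel vector of one user. -/
noncomputable def userLaw (r : ℕ) (τ : ℝ≥0) : Measure (Fin r → ℂ) :=
  Measure.pi fun _ => complexGaussian τ

instance (r : ℕ) (τ : ℝ≥0) : IsProbabilityMeasure (userLaw r τ) := by
  unfold userLaw; infer_instance

lemma channelLaw_eq (K r : ℕ) (τ : ℝ≥0) :
    channelLaw K r τ = Measure.pi fun _ => userLaw r τ := rfl

instance (K r : ℕ) (τ : ℝ≥0) : IsProbabilityMeasure (channelLaw K r τ) := by
  rw [channelLaw_eq]; infer_instance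

lemma prod_complexGaussianPDF {r : ℕ} (τ : ℝ≥0) (v : Fin r → ℂ) :
    ∏ n, complexGaussianPDF τ (v n) =
      (2 * Real.pi * τ)⁻¹ ^ r * Real.exp (-channelGain v / (2 * τ)) := by
  simp only [complexGaussianPDF, Finset.prod_mul_distrib, Finset.prod_const, Finset.card_univ,
    Fintype.card_fin, ← Real.exp_sum, channelGain, ← Finset.sum_neg_distrib, Finset.sum_div]

lemma userLaw_eq_withDensity {r : ℕ} {τ : ℝ≥0} (hτ : τ ≠ 0) :
    userLaw r τ = volume.withDensity fun v =>
      ENNReal.ofReal (∏ n, complexGaussianPDF τ (v n)) := by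
  refine Measure.pi_eq fun s hs => ?_
  rw [withDensity_apply _ (MeasurableSet.univ_pi hs), complexGaussian_eq_withDensity hτ]
  have hv : (volume : Measure (Fin r → ℂ)) = Measure.pi fun _ => volume := rfl
  have hi : ∀ n, Integrable (complexGaussianPDF τ) (volume.restrict (s n)) := fun n =>
    (integrable_complexGaussianPDF hτ).integrableOn
  rw [hv, Measure.restrict_pi_pi, ← ofReal_integral_eq_lintegral_ofReal
      (Integrable.fintype_prod (f := fun _ => complexGaussianPDF τ) hi)
      (.of_forall fun v => Finset.prod_nonneg fun n _ => complexGaussianPDF_nonneg τ _),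
    integral_fintype_prod_eq_prod (fun _ => complexGaussianPDF τ),
    ENNReal.ofReal_prod_of_nonneg fun n _ => integral_nonneg (complexGaussianPDF_nonneg τ)]
  refine Finset.prod_congr rfl fun n _ => ?_
  rw [withDensity_apply _ (hs n),
    ofReal_integral_eq_lintegral_ofReal (hi n) (.of_forall (complexGaussianPDF_nonneg τ))]

lemma continuous_channelGain {r : ℕ} : Continuous (channelGain (r := r)) := by
  unfold channelGain; fun_prop

lemma channelGain_nonneg {r : ℕ} (v : Fin r → ℂ) : 0 ≤ channelGain v :=
  Finset.sum_nonneg fun _ _ => by positivity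

/-- Integration in polar coordinates of a function of the squared norm. -/
lemma exists_integral_comp_channelGain {r : ℕ} (hr : 1 ≤ r) : ∃ C : ℝ, ∀ g : ℝ → ℝ,
    ∫ v : Fin r → ℂ, g (channelGain v) = C * ∫ s in Set.Ioi (0 : ℝ), s ^ (r - 1) * g s := by
  have : Nonempty (Fin r) := ⟨⟨0, hr⟩⟩
  -- The function type carries the sup norm, so volume is transported to the Euclidean space, where
  -- polar coordinates apply to any Haar measure. The constant need not be evaluated.
  let e : EuclideanSpace ℂ (Fin r) ≃L[ℝ] (Fin r → ℂ) :=
    PiLp.continuousLinearEquiv 2 ℝ fun _ => ℂ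
  let μ : Measure (EuclideanSpace ℂ (Fin r)) := Measure.map e.symm volume
  have : μ.IsAddHaarMeasure := e.symm.isAddHaarMeasure_map volume
  have hdim : Module.finrank ℝ (EuclideanSpace ℂ (Fin r)) = 2 * r := by
    rw [e.toLinearEquiv.finrank_eq, Module.finrank_pi_fintype]
    simp [Complex.finrank_real_complex, mul_comm]
  refine ⟨r * μ.real (Metric.ball 0 1), fun g => ?_⟩
  have h1 : ∫ v : Fin r → ℂ, g (channelGain v) = ∫ y, g (‖y‖ ^ 2) ∂μ := by
    rw [show μ = Measure.map e.symm.toHomeomorph.toMeasurableEquiv volume from rfl,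
      integral_map_equiv]
    refine integral_congr_ae (.of_forall fun v => ?_)
    simp only [EuclideanSpace.norm_sq_eq, channelGain]
    rfl
  rw [h1, integral_fun_norm_addHaar μ (fun y => g (y ^ 2)), hdim]
  -- Substitution s = y²: the radial weight y^(2r-1) of real dimension 2r becomes s^(r-1)/2.
  have h2 := integral_comp_rpow_Ioi_of_pos (g := fun s => s ^ (r - 1) * g s)
    (p := 2) two_pos
  have h3 : ∫ y in Set.Ioi (0 : ℝ), y ^ (2 * r - 1) • g (y ^ 2) =
      1 / 2 * ∫ s in Set.Ioi (0 : ℝ), s ^ (r - 1) * g s := by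
    rw [← h2, ← integral_const_mul]
    refine setIntegral_congr_fun measurableSet_Ioi fun y hy => ?_
    obtain ⟨m, rfl⟩ : ∃ m, r = m + 1 := ⟨r - 1, by omega⟩
    have : 2 * (m + 1) - 1 = 2 * m + 1 := by omega
    simp only [smul_eq_mul, this, Nat.add_sub_cancel, Real.rpow_two]
    norm_num
    ring
  rw [h3]
  simp only [nsmul_eq_mul, smul_eq_mul]
  push_cast
  ring

/-- The squared norm of a channel vector is `2τ` times a Gamma variable of shape `r`. -/
lemma integral_comp_channelGain_userLaw {r : ℕ} (hr : 1 ≤ r) {τ : ℝ≥0} (hτ : 0 < τ) (g : ℝ → ℝ) :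
    ∫ v, g (channelGain v) ∂(userLaw r τ) =
      ((r - 1)! : ℝ)⁻¹ * ∫ s in Set.Ioi (0 : ℝ), s ^ (r - 1) * Real.exp (-s) * g (2 * τ * s) := by
  have hτ' : (0 : ℝ) < 2 * τ := by positivity
  obtain ⟨C, hC⟩ := exists_integral_comp_channelGain hr
  have key : ∃ C' : ℝ, ∀ g : ℝ → ℝ, ∫ v, g (channelGain v) ∂(userLaw r τ) =
      C' * ∫ s in Set.Ioi (0 : ℝ), s ^ (r - 1) * Real.exp (-s) * g (2 * τ * s) := by
    refine ⟨(2 * Real.pi * τ)⁻¹ ^ r * C * (2 * τ) ^ r, fun g => ?_⟩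
    have hm : Measurable fun v : Fin r → ℂ => ∏ n, complexGaussianPDF τ (v n) :=
      (continuous_finsetProd _ fun n _ =>
        (continuous_complexGaussianPDF τ).comp (continuous_apply n)).measurable
    rw [userLaw_eq_withDensity hτ.ne', integral_withDensity_eq_integral_toReal_smul
      hm.ennreal_ofReal (.of_forall fun _ => ENNReal.ofReal_lt_top)]
    have h1 : ∀ v : Fin r → ℂ,
        (ENNReal.ofReal (∏ n, complexGaussianPDF τ (v n))).toReal • g (channelGain v) =
        (fun s => (2 * Real.pi * τ)⁻¹ ^ r * (Real.exp (-s / (2 * τ)) * g s)) (channelGain v) := by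
      intro v
      rw [ENNReal.toReal_ofReal (Finset.prod_nonneg fun n _ => complexGaussianPDF_nonneg τ _),
        prod_complexGaussianPDF, smul_eq_mul, mul_assoc]
    rw [integral_congr_ae (.of_forall h1),
      hC fun s => (2 * Real.pi * τ)⁻¹ ^ r * (Real.exp (-s / (2 * τ)) * g s)]
    have h2 := integral_comp_mul_left_Ioi
      (fun s => s ^ (r - 1) * (Real.exp (-s / (2 * τ)) * g s)) 0 hτ'
    rw [mul_zero, smul_eq_mul] at h2
    have h3 : ∫ s in Set.Ioi (0 : ℝ), s ^ (r - 1) *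
        ((2 * Real.pi * τ)⁻¹ ^ r * (Real.exp (-s / (2 * τ)) * g s)) =
        (2 * Real.pi * τ)⁻¹ ^ r * ((2 * τ) * ∫ s in Set.Ioi (0 : ℝ), (2 * τ * s) ^ (r - 1) *
          (Real.exp (-(2 * τ * s) / (2 * τ)) * g (2 * τ * s))) := by
      rw [h2, ← mul_assoc (2 * (τ : ℝ)), mul_inv_cancel₀ hτ'.ne', one_mul, ← integral_const_mul]
      refine integral_congr_ae (.of_forall fun s => ?_)
      simp only
      ring
    rw [h3]
    have h4 : ∫ s in Set.Ioi (0 : ℝ), (2 * τ * s) ^ (r - 1) *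
          (Real.exp (-(2 * τ * s) / (2 * τ)) * g (2 * τ * s)) =
        (2 * τ) ^ (r - 1) *
          ∫ s in Set.Ioi (0 : ℝ), s ^ (r - 1) * Real.exp (-s) * g (2 * τ * s) := by
      rw [← integral_const_mul]
      refine integral_congr_ae (.of_forall fun s => ?_)
      have : -(2 * (τ : ℝ) * s) / (2 * τ) = -s := by field_simp
      simp only [this, mul_pow]
      ring
    rw [h4]
    obtain ⟨m, rfl⟩ : ∃ m, r = m + 1 := ⟨r - 1, by omega⟩
    simp only [Nat.add_sub_cancel, pow_succ]
    ring
  obtain ⟨C', hC'⟩ := key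
  -- The unknown constant is fixed by total mass 1.
  have h1 := hC' fun _ => 1
  have hΓ : ∫ s in Set.Ioi (0 : ℝ), s ^ (r - 1) * Real.exp (-s) * 1 = ((r - 1)! : ℝ) := by
    rw [← Real.Gamma_nat_eq_factorial, Real.Gamma_eq_integral (by positivity)]
    refine setIntegral_congr_fun measurableSet_Ioi fun s _ => ?_
    simp only [add_sub_cancel_right, Real.rpow_natCast]
    ring
  rw [hΓ] at h1
  simp only [integral_const, probReal_univ, smul_eq_mul, mul_one] at h1
  rw [hC', eq_inv_of_mul_eq_one_left h1.symm]

lemma integrable_channelGain_pow {r : ℕ} (hr : 1 ≤ r) {τ : ℝ≥0} (hτ : 0 < τ) (l : ℕ) :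
    Integrable (fun v => channelGain v ^ l) (userLaw r τ) := by
  -- A non-integrable function has Bochner integral 0, so a nonzero value of the integral proves
  -- integrability.
  refine not_imp_comm.1 integral_undef ?_
  rw [integral_comp_channelGain_userLaw hr hτ fun s => s ^ l]
  have : ∫ s in Set.Ioi (0 : ℝ), s ^ (r - 1) * Real.exp (-s) * (2 * τ * s) ^ l =
      (2 * τ) ^ l * ((r - 1 + l)! : ℝ) := by
    rw [← Real.Gamma_nat_eq_factorial, Real.Gamma_eq_integral (by positivity),
      ← integral_const_mul]
    refine setIntegral_congr_fun measurableSet_Ioi fun s _ => ?_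
    simp only [add_sub_cancel_right, Real.rpow_natCast, mul_pow, pow_add]
    ring
  rw [this]
  positivity

/-! ### Tail moments of the Gamma law, its quantile and the normalizing constant -/

/-- The moment `∫_0^∞ t^l (1 + t / x)^n e^{-t} dt`; divided by `gammaTailMoment n 0 x` it is the
`l`-th moment of the excess over `x` of a Gamma variable of shape `n + 1`. -/
noncomputable def gammaTailMoment (n l : ℕ) (x : ℝ) : ℝ :=
  ∫ t in Set.Ioi (0 : ℝ), t ^ l * ((1 + t / x) ^ n * Real.exp (-t))

lemma integrableOn_pow_mul_exp_neg (m : ℕ) :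
    IntegrableOn (fun t : ℝ => t ^ m * Real.exp (-t)) (Set.Ioi 0) := by
  have h := Real.GammaIntegral_convergent (s := m + 1) (by positivity)
  refine h.congr_fun (fun t _ => ?_) measurableSet_Ioi
  simp only [add_sub_cancel_right, Real.rpow_natCast]
  ring

lemma integral_pow_mul_exp_neg (m : ℕ) :
    ∫ t in Set.Ioi (0 : ℝ), t ^ m * Real.exp (-t) = (m ! : ℝ) := by
  rw [← Real.Gamma_nat_eq_factorial, Real.Gamma_eq_integral (by positivity)]
  refine setIntegral_congr_fun measurableSet_Ioi fun s _ => ?_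
  simp only [add_sub_cancel_right, Real.rpow_natCast]
  ring

lemma integrableOn_gammaTailMoment (n l : ℕ) (x : ℝ) :
    IntegrableOn (fun t : ℝ => t ^ l * ((1 + t / x) ^ n * Real.exp (-t))) (Set.Ioi 0) := by
  have h : ∀ t : ℝ, t ^ l * ((1 + t / x) ^ n * Real.exp (-t)) =
      ∑ m ∈ Finset.range (n + 1),
        ((x⁻¹ ^ (n - m) * n.choose m) * (t ^ (n - m + l) * Real.exp (-t))) := by
    intro t
    rw [add_pow, Finset.sum_mul, Finset.mul_sum]
    refine Finset.sum_congr rfl fun m _ => ?_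
    rw [div_eq_mul_inv, mul_pow, pow_add]
    ring
  simp_rw [h]
  exact integrable_finsetSum _ fun m _ => (integrableOn_pow_mul_exp_neg _).const_mul _

/-- Bernoulli's inequality under the integral. With `gammaTailMoment_le` it gives the expansion in
1/x up to O(x⁻²). -/
lemma gammaTailMoment_ge (n l : ℕ) {x : ℝ} (hx : 0 < x) :
    (l ! : ℝ) + n * ((l + 1)! : ℝ) / x ≤ gammaTailMoment n l x := by
  have h : (l ! : ℝ) + n * ((l + 1)! : ℝ) / x =
      ∫ t in Set.Ioi (0 : ℝ), (t ^ l * Real.exp (-t) + n / x * (t ^ (l + 1) * Real.exp (-t))) := by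
    rw [integral_add (integrableOn_pow_mul_exp_neg _)
      ((integrableOn_pow_mul_exp_neg _).const_mul _), integral_const_mul,
      integral_pow_mul_exp_neg, integral_pow_mul_exp_neg]
    ring
  rw [h]
  refine setIntegral_mono_on ((integrableOn_pow_mul_exp_neg _).add
    ((integrableOn_pow_mul_exp_neg _).const_mul _)) (integrableOn_gammaTailMoment n l x)
    measurableSet_Ioi fun t ht => ?_
  have ht : 0 < t := ht
  have hb := one_add_mul_le_pow (a := t / x) (by have := div_pos ht hx; linarith) n
  calc t ^ l * Real.exp (-t) + n / x * (t ^ (l + 1) * Real.exp (-t))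
      = t ^ l * ((1 + n * (t / x)) * Real.exp (-t)) := by ring
    _ ≤ _ := by gcongr

lemma factorial_le_gammaTailMoment (n l : ℕ) {x : ℝ} (hx : 0 < x) :
    (l ! : ℝ) ≤ gammaTailMoment n l x :=
  le_trans (le_add_of_nonneg_right (by positivity)) (gammaTailMoment_ge n l hx)

lemma gammaTailMoment_pos (n l : ℕ) {x : ℝ} (hx : 0 < x) : 0 < gammaTailMoment n l x :=
  lt_of_lt_of_le (by positivity) (factorial_le_gammaTailMoment n l hx)

/-- The integrand decreases in x, so the value at 1 serves as a bound uniform in x. -/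
lemma gammaTailMoment_le_one (n l : ℕ) {x : ℝ} (hx : 1 ≤ x) :
    gammaTailMoment n l x ≤ gammaTailMoment n l 1 := by
  refine setIntegral_mono_on (integrableOn_gammaTailMoment n l x)
    (integrableOn_gammaTailMoment n l 1) measurableSet_Ioi fun t ht => ?_
  have ht : 0 < t := ht
  gcongr

/-- A second-order bound of `(1 + t y)^n` for `0 ≤ y ≤ 1`. -/
lemma one_add_mul_pow_le (n : ℕ) {t y : ℝ} (ht : 0 ≤ t) (hy : 0 ≤ y) (hy1 : y ≤ 1) :
    (1 + t * y) ^ n ≤ 1 + n * (t * y) + y ^ 2 * (1 + t) ^ n := by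
  rw [add_comm (1 : ℝ) t, add_pow t, add_comm (1 : ℝ), add_pow]
  rcases n with _ | _ | n
  · simp; positivity
  · simp [Finset.sum_range_succ]
    nlinarith [mul_nonneg (sq_nonneg y) (add_nonneg ht zero_le_one)]
  · rw [Finset.sum_range_succ', Finset.sum_range_succ', Finset.sum_range_succ' _ (n + 2),
      Finset.sum_range_succ' _ (n + 1)]
    simp only [one_pow, mul_one, pow_zero, zero_add, pow_one,
      Nat.choose_zero_right, Nat.cast_one, Nat.choose_one_right]
    -- In the terms of degree at least 2, each power of y is at most y².
    have h : ∑ k ∈ Finset.range (n + 1), (t * y) ^ (k + 1 + 1) * ((n + 1 + 1).choose (k + 1 + 1) : ℝ)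
        ≤ y ^ 2 * ∑ k ∈ Finset.range (n + 1), t ^ (k + 1 + 1) * ((n + 1 + 1).choose (k + 1 + 1) : ℝ) := by
      rw [Finset.mul_sum]
      refine Finset.sum_le_sum fun k _ => ?_
      have : y ^ (k + 1 + 1) ≤ y ^ 2 := pow_le_pow_of_le_one hy hy1 (by omega)
      calc (t * y) ^ (k + 1 + 1) * ((n + 1 + 1).choose (k + 1 + 1) : ℝ)
          = y ^ (k + 1 + 1) * (t ^ (k + 1 + 1) * ((n + 1 + 1).choose (k + 1 + 1) : ℝ)) := by
            rw [mul_pow]; ring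
        _ ≤ _ := by gcongr
    have h2 : 0 ≤ y ^ 2 * (t * ((n + 1 + 1 : ℕ) : ℝ) + 1) := by positivity
    nlinarith [h, h2]

lemma gammaTailMoment_le (n l : ℕ) {x : ℝ} (hx : 1 ≤ x) :
    gammaTailMoment n l x ≤
      (l ! : ℝ) + n * ((l + 1)! : ℝ) / x + gammaTailMoment n l 1 / x ^ 2 := by
  have hi : IntegrableOn (fun t : ℝ =>
      t ^ l * Real.exp (-t) + n / x * (t ^ (l + 1) * Real.exp (-t))) (Set.Ioi 0) :=
    (integrableOn_pow_mul_exp_neg l).add ((integrableOn_pow_mul_exp_neg (l + 1)).const_mul (n / x))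
  have hi1 := (integrableOn_gammaTailMoment n l 1).const_mul (1 / x ^ 2)
  have h : (l ! : ℝ) + n * ((l + 1)! : ℝ) / x + gammaTailMoment n l 1 / x ^ 2 =
      ∫ t in Set.Ioi (0 : ℝ), (t ^ l * Real.exp (-t) + n / x * (t ^ (l + 1) * Real.exp (-t)) +
        1 / x ^ 2 * (t ^ l * ((1 + t / 1) ^ n * Real.exp (-t)))) := by
    rw [integral_add hi hi1, integral_add (integrableOn_pow_mul_exp_neg _)
      ((integrableOn_pow_mul_exp_neg _).const_mul _), integral_const_mul, integral_const_mul,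
      integral_pow_mul_exp_neg, integral_pow_mul_exp_neg, gammaTailMoment]
    ring
  rw [h]
  refine setIntegral_mono_on (integrableOn_gammaTailMoment n l x) (hi.add hi1)
    measurableSet_Ioi fun t ht => ?_
  have ht : 0 < t := ht
  have hb := one_add_mul_pow_le n ht.le (y := x⁻¹) (by positivity) (inv_le_one_of_one_le₀ hx)
  calc t ^ l * ((1 + t / x) ^ n * Real.exp (-t))
      ≤ t ^ l * ((1 + n * (t * x⁻¹) + x⁻¹ ^ 2 * (1 + t) ^ n) * Real.exp (-t)) := by
        rw [div_eq_mul_inv]; gcongr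
    _ = _ := by rw [div_one]; ring

lemma setIntegral_Ioi_eq_shift (f : ℝ → ℝ) (x : ℝ) :
    ∫ t in Set.Ioi x, f t = ∫ t in Set.Ioi (0 : ℝ), f (t + x) := by
  have h := (measurePreserving_add_right volume x).setIntegral_preimage_emb
    (measurableEmbedding_addRight x) f (Set.Ioi x)
  rw [← h]
  simp

/-- The tail of a Gamma integral in terms of the excess over `x`. -/
lemma setIntegral_Ioi_gamma (n : ℕ) (f : ℝ → ℝ) {x : ℝ} (hx : 0 < x) :
    ∫ t in Set.Ioi x, t ^ n * Real.exp (-t) * f t = x ^ n * Real.exp (-x) *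
      ∫ t in Set.Ioi (0 : ℝ), f (x + t) * ((1 + t / x) ^ n * Real.exp (-t)) := by
  rw [setIntegral_Ioi_eq_shift, ← integral_const_mul]
  refine integral_congr_ae (.of_forall fun t => ?_)
  have h1 : (t + x) ^ n = x ^ n * (1 + t / x) ^ n := by
    rw [← mul_pow]; congr 1; field_simp; ring
  simp only [h1, neg_add, Real.exp_add, add_comm x t]
  ring

lemma upperGamma_nat {r : ℕ} (hr : 1 ≤ r) (x : ℝ) :
    upperGamma r x = ∫ t in Set.Ioi x, t ^ (r - 1) * Real.exp (-t) := by
  unfold upperGamma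
  have : (r : ℝ) - 1 = ((r - 1 : ℕ) : ℝ) := by push_cast [Nat.cast_sub hr]; ring
  simp_rw [this, Real.rpow_natCast]

lemma upperGamma_eq_gammaTailMoment {r : ℕ} (hr : 1 ≤ r) {x : ℝ} (hx : 0 < x) :
    upperGamma r x = x ^ (r - 1) * Real.exp (-x) * gammaTailMoment (r - 1) 0 x := by
  rw [upperGamma_nat hr]
  have := setIntegral_Ioi_gamma (r - 1) (fun _ => 1) hx
  simpa [gammaTailMoment] using this

lemma Gamma_nat {r : ℕ} (hr : 1 ≤ r) : Real.Gamma r = ((r - 1)! : ℝ) := by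
  rw [← Real.Gamma_nat_eq_factorial]; push_cast [Nat.cast_sub hr]; ring_nf

lemma regGammaQ_eq {r : ℕ} (hr : 1 ≤ r) {x : ℝ} (hx : 0 < x) : regGammaQ r x =
    x ^ (r - 1) * Real.exp (-x) * gammaTailMoment (r - 1) 0 x / ((r - 1)! : ℝ) := by
  rw [regGammaQ, Gamma_nat hr, upperGamma_eq_gammaTailMoment hr hx]

lemma regGammaQ_pos {r : ℕ} (hr : 1 ≤ r) {x : ℝ} (hx : 0 < x) : 0 < regGammaQ r x := by
  rw [regGammaQ_eq hr hx]
  have := gammaTailMoment_pos (r - 1) 0 hx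
  positivity

lemma regGammaQ_anti {r : ℕ} (hr : 1 ≤ r) {x y : ℝ} (hx : 0 ≤ x) (hxy : x ≤ y) :
    regGammaQ r y ≤ regGammaQ r x := by
  unfold regGammaQ
  rw [upperGamma_nat hr, upperGamma_nat hr, Gamma_nat hr]
  refine div_le_div_of_nonneg_right (setIntegral_mono_set
    ((integrableOn_pow_mul_exp_neg _).mono_set (Set.Ioi_subset_Ioi hx)) ?_
    (Set.Ioi_subset_Ioi hxy).eventuallyLE) (by positivity)
  filter_upwards [ae_restrict_mem measurableSet_Ioi] with t ht
  have : 0 < t := lt_of_le_of_lt hx ht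
  show 0 ≤ _
  positivity

lemma regGammaQ_zero {r : ℕ} (hr : 1 ≤ r) : regGammaQ r 0 = 1 := by
  rw [regGammaQ, upperGamma_nat hr, Gamma_nat hr, integral_pow_mul_exp_neg, div_self]
  positivity

lemma continuousOn_regGammaQ {r : ℕ} (hr : 1 ≤ r) : ContinuousOn (regGammaQ r) (Set.Ici 0) := by
  unfold regGammaQ
  refine ContinuousOn.div_const ?_ _
  have hc : Continuous fun t : ℝ => t ^ (r - 1) * Real.exp (-t) := by fun_prop
  have h := intervalIntegral.continuous_primitive (μ := volume)
    (fun a b => hc.intervalIntegrable a b) 0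
  refine ((continuous_const (y := ∫ t in Set.Ioi (0 : ℝ), t ^ (r - 1) * Real.exp (-t))).sub
    h).continuousOn.congr fun x hx => ?_
  rw [upperGamma_nat hr, ← intervalIntegral.integral_interval_add_Ioi
    (integrableOn_pow_mul_exp_neg (r - 1))
    ((integrableOn_pow_mul_exp_neg (r - 1)).mono_set (Set.Ioi_subset_Ioi hx))]
  simp only [Pi.sub_apply]
  ring

/-- This superpolynomial decay makes the Poisson correction negligible against the margins of order
1 and x⁻² found below. -/
lemma tendsto_pow_mul_regGammaQ {r : ℕ} (hr : 1 ≤ r) (m : ℕ) :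
    Tendsto (fun x => x ^ m * regGammaQ r x) atTop (𝓝 0) := by
  have h := (Real.tendsto_pow_mul_exp_neg_atTop_nhds_zero (m + (r - 1))).mul_const
    (gammaTailMoment (r - 1) 0 1 / ((r - 1)! : ℝ))
  rw [zero_mul] at h
  refine tendsto_of_tendsto_of_tendsto_of_le_of_le' tendsto_const_nhds h ?_ ?_
  · filter_upwards [eventually_gt_atTop 0] with x hx
    have := regGammaQ_pos hr hx
    positivity
  · filter_upwards [eventually_ge_atTop 1] with x hx
    rw [regGammaQ_eq hr (by positivity)]
    have := gammaTailMoment_le_one (r - 1) 0 hx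
    have h0 : (0 : ℝ) < x := by positivity
    calc x ^ m * (x ^ (r - 1) * Real.exp (-x) * gammaTailMoment (r - 1) 0 x / ((r - 1)! : ℝ))
        = x ^ (m + (r - 1)) * Real.exp (-x) *
          (gammaTailMoment (r - 1) 0 x / ((r - 1)! : ℝ)) := by rw [pow_add]; ring
      _ ≤ _ := by gcongr

lemma tendsto_regGammaQ {r : ℕ} (hr : 1 ≤ r) : Tendsto (regGammaQ r) atTop (𝓝 0) := by
  simpa using tendsto_pow_mul_regGammaQ hr 0

lemma regGammaQInv_spec {r : ℕ} (hr : 1 ≤ r) {y : ℝ} (hy : 0 < y) (hy1 : y ≤ 1) :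
    0 ≤ regGammaQInv r y ∧ regGammaQ r (regGammaQInv r y) = y := by
  have hex : ∃ a ∈ Set.Ici (0 : ℝ), regGammaQ r a = y := by
    obtain ⟨b, hb, hb0⟩ := (((tendsto_regGammaQ hr).eventually (eventually_lt_nhds hy)).and
      (eventually_ge_atTop 0)).exists
    obtain ⟨a, ha, h⟩ := intermediate_value_Icc' hb0
      ((continuousOn_regGammaQ hr).mono Set.Icc_subset_Ici_self)
      ⟨hb.le, (regGammaQ_zero hr).symm ▸ hy1⟩
    exact ⟨a, ha.1, h⟩
  exact ⟨Function.invFunOn_mem hex, Function.invFunOn_eq hex⟩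

/-- The normalizing constant is twice the inverse hazard rate at its quantile. -/
lemma normConstA_eq {r K : ℕ} (hr : 1 ≤ r) (hK : 1 ≤ K)
    (hq : 0 < regGammaQInv r (1 / (K : ℝ))) : normConstA K r =
      2 * gammaTailMoment (r - 1) 0 (regGammaQInv r (1 / (K : ℝ))) := by
  have hK' : (0 : ℝ) < K := by exact_mod_cast hK
  have hs := (regGammaQInv_spec hr (y := 1 / (K : ℝ)) (by positivity)
    (by rw [div_le_one hK']; exact_mod_cast hK)).2
  unfold normConstA
  set q := regGammaQInv r (1 / (K : ℝ))
  rw [regGammaQ_eq hr hq] at hs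
  have he : (1 : ℝ) - r = -((r - 1 : ℕ) : ℝ) := by push_cast [Nat.cast_sub hr]; ring
  rw [Gamma_nat hr, he, Real.rpow_neg hq.le, Real.rpow_natCast]
  have h2 : 2 / (K : ℝ) = 2 * (1 / (K : ℝ)) := by ring
  -- With 1/K replaced by Q(r, q), the factors Γ(r), exp(q) and q^(1-r) cancel and only the tail
  -- moment survives.
  rw [h2, ← hs, Real.exp_neg]
  field_simp

lemma tendsto_gammaTailMoment_zero (n : ℕ) :
    Tendsto (gammaTailMoment n 0) atTop (𝓝 1) := by
  have h : Tendsto (fun x : ℝ => (1 : ℝ) + n / x + gammaTailMoment n 0 1 / x ^ 2) atTop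
      (𝓝 (1 + 0 + 0)) :=
    (tendsto_const_nhds.add (tendsto_const_nhds.div_atTop tendsto_id)).add
      (tendsto_const_nhds.div_atTop (tendsto_pow_atTop two_ne_zero))
  rw [add_zero, add_zero] at h
  refine tendsto_of_tendsto_of_tendsto_of_le_of_le' tendsto_const_nhds h ?_ ?_
  · filter_upwards [eventually_gt_atTop 0] with x hx
    simpa using factorial_le_gammaTailMoment n 0 hx
  · filter_upwards [eventually_ge_atTop 1] with x hx
    simpa using gammaTailMoment_le n 0 hx

lemma tendsto_gammaTailMoment_div (n l m : ℕ) (hm : m ≠ 0) :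
    Tendsto (fun x => gammaTailMoment n l x / gammaTailMoment n 0 x / x ^ m) atTop (𝓝 0) := by
  have h : Tendsto (fun x : ℝ => gammaTailMoment n l 1 / x ^ m) atTop (𝓝 0) :=
    tendsto_const_nhds.div_atTop (tendsto_pow_atTop hm)
  refine tendsto_of_tendsto_of_tendsto_of_le_of_le' tendsto_const_nhds h ?_ ?_
  · filter_upwards [eventually_gt_atTop 0] with x hx
    have h1 := gammaTailMoment_pos n l hx
    have h2 := gammaTailMoment_pos n 0 hx
    positivity
  · filter_upwards [eventually_ge_atTop 1] with x hx
    have hx0 : (0 : ℝ) < x := by positivity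
    have h0 := gammaTailMoment_pos n l hx0
    have h1 : 1 ≤ gammaTailMoment n 0 x := by simpa using factorial_le_gammaTailMoment n 0 hx0
    have h2 := gammaTailMoment_le_one n l hx
    have h3 : gammaTailMoment n l x / gammaTailMoment n 0 x ≤ gammaTailMoment n l 1 :=
      (div_le_self h0.le h1).trans h2
    gcongr

/-- If the tail probabilities at `x` and at a large `q` are comparable, then the inverse hazard
rate at `q` is at least its second-order expansion at `x` up to `1 / (8 x)`. -/
lemma eventually_le_gammaTailMoment {r : ℕ} (hr : 1 ≤ r) (κ : ℝ) :
    ∀ᶠ q in atTop, ∀ x, 0 < x → regGammaQ r x ≤ κ * regGammaQ r q →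
      1 + (((r - 1 : ℕ) : ℝ) - 1 / 8) / x ≤ gammaTailMoment (r - 1) 0 q := by
  set n := r - 1 with hn
  -- Chosen so that nε ≤ 1/8, with n + 1 in the denominator to keep 0 < ε < 1 when n = 0 too.
  set ε : ℝ := 1 / 8 / (n + 1) with hε
  have hn1 : (0 : ℝ) < n + 1 := by positivity
  have hε0 : 0 < ε := by positivity
  have hε1 : ε < 1 := by rw [hε, div_lt_one hn1]; linarith [(Nat.cast_nonneg n : (0 : ℝ) ≤ n)]
  have hlim : Tendsto (fun q : ℝ => (1 - ε) ^ n * Real.exp (ε * q)) atTop atTop :=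
    (Real.tendsto_exp_atTop.comp (tendsto_id.const_mul_atTop hε0)).const_mul_atTop
      (pow_pos (by linarith) n)
  filter_upwards [hlim.eventually_gt_atTop (|κ| * gammaTailMoment n 0 1),
    eventually_ge_atTop 1] with q hq hq1 x hx hQ
  have hq0 : 0 < q := by positivity
  have hge : 1 + (n : ℝ) / q ≤ gammaTailMoment n 0 q := by
    simpa using gammaTailMoment_ge n 0 hq0
  refine le_trans ?_ hge
  suffices h : (n : ℝ) * (q - x) ≤ 1 / 8 * q by
    have h2 : (n : ℝ) / q - (n - 1 / 8) / x = (1 / 8 * q - n * (q - x)) / (q * x) := by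
      field_simp; ring
    have : 0 ≤ (1 / 8 * q - n * (q - x)) / (q * x) := div_nonneg (by linarith) (by positivity)
    linarith
  by_cases hxq : (1 - ε) * q ≤ x
  · have h1 : q - x ≤ ε * q := by linarith
    have h2 : (n : ℝ) * (ε * q) ≤ 1 / 8 * q := by
      have : (n : ℝ) * ε ≤ 1 / 8 := by
        rw [hε, mul_div_assoc', div_le_iff₀ hn1]; nlinarith
      nlinarith
    exact (mul_le_mul_of_nonneg_left h1 (Nat.cast_nonneg n)).trans h2
  -- If x lay below (1-ε)q, the tail at x would exceed the tail at q by a factor of order (1-ε)^n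
  -- exp(εq), which is unbounded in q, against the assumed ratio κ.
  · exfalso
    push Not at hxq
    have hb : 0 < (1 - ε) * q := mul_pos (by linarith) hq0
    have h1 := (regGammaQ_anti hr hx.le hxq.le).trans hQ
    rw [regGammaQ_eq hr hb, regGammaQ_eq hr hq0, ← hn, mul_div_assoc',
      div_le_div_iff_of_pos_right (by positivity)] at h1
    have h2 : 1 ≤ gammaTailMoment n 0 ((1 - ε) * q) := by
      simpa using factorial_le_gammaTailMoment n 0 hb
    have h3 := gammaTailMoment_le_one n 0 hq1
    have h4 : 0 < gammaTailMoment n 0 q := gammaTailMoment_pos n 0 hq0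
    have hexp : Real.exp (-((1 - ε) * q)) = Real.exp (-q) * Real.exp (ε * q) := by
      rw [← Real.exp_add]; ring_nf
    have h5 : q ^ n * Real.exp (-q) * ((1 - ε) ^ n * Real.exp (ε * q)) ≤
        q ^ n * Real.exp (-q) * (|κ| * gammaTailMoment n 0 1) := by
      calc q ^ n * Real.exp (-q) * ((1 - ε) ^ n * Real.exp (ε * q))
          = ((1 - ε) * q) ^ n * Real.exp (-((1 - ε) * q)) * 1 := by rw [hexp, mul_pow]; ring
        _ ≤ ((1 - ε) * q) ^ n * Real.exp (-((1 - ε) * q)) *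
            gammaTailMoment n 0 ((1 - ε) * q) := by gcongr
        _ ≤ κ * (q ^ n * Real.exp (-q) * gammaTailMoment n 0 q) := h1
        _ ≤ |κ| * (q ^ n * Real.exp (-q) * gammaTailMoment n 0 1) := by
            gcongr; exact le_abs_self κ
        _ = _ := by ring
    have := le_of_mul_le_mul_left h5 (by positivity)
    linarith

/-! ### Logarithm estimates and asymptotic comparison at high thresholds -/

/-- The difference of the two sides vanishes at 0 and has derivative z³/(1+z). -/
lemma log_one_add_le_cubic {z : ℝ} (hz : 0 ≤ z) :
    Real.log (1 + z) ≤ z - z ^ 2 / 2 + z ^ 3 / 3 := by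
  let f : ℝ → ℝ := fun z => z - z ^ 2 / 2 + z ^ 3 / 3 - Real.log (1 + z)
  have hd : ∀ x ∈ Set.Ici (0 : ℝ), HasDerivAt f (1 - x + x ^ 2 - 1 / (1 + x)) x := by
    intro x hx
    have hx' : (1 : ℝ) + x ≠ 0 := by have : (0 : ℝ) ≤ x := hx; positivity
    have h1 := (((hasDerivAt_id x).sub ((hasDerivAt_pow 2 x).div_const 2)).add
      ((hasDerivAt_pow 3 x).div_const 3)).sub (((hasDerivAt_id x).const_add 1).log hx')
    refine h1.congr_deriv ?_
    simp only [id]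
    push_cast
    ring
  have hmono : MonotoneOn f (Set.Ici 0) := by
    refine monotoneOn_of_deriv_nonneg (convex_Ici 0)
      (fun x hx => (hd x hx).continuousAt.continuousWithinAt)
      (fun x hx => (hd x (interior_subset hx)).differentiableAt.differentiableWithinAt)
      fun x hx => ?_
    have hx0 : (0 : ℝ) ≤ x := interior_subset hx
    rw [(hd x hx0).deriv]
    have : 1 - x + x ^ 2 - 1 / (1 + x) = x ^ 3 / (1 + x) := by field_simp; ring
    rw [this]; positivity
  have h := hmono (Set.mem_Ici.2 le_rfl) hz hz
  simp only [f] at h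
  norm_num at h
  linarith

lemma le_log_one_add_quadratic {z : ℝ} (hz : 0 ≤ z) :
    z - z ^ 2 / 2 ≤ Real.log (1 + z) := by
  -- The intermediate bound is 2z/(z+2).
  refine le_trans ?_ (Real.le_log_one_add_of_nonneg hz)
  rw [le_div_iff₀ (by positivity)]
  nlinarith [pow_nonneg hz 3]

set_option maxHeartbeats 400000 in
/-- The second-order comparison behind the one-transmitter term. -/
lemma eventually_single_user_bound {r : ℕ} (hr : 1 ≤ r) {P τ : ℝ} (hP : 0 < P) (hτ : 0 < τ)
    (hτ1 : τ ≤ 1) : ∀ᶠ x in atTop, ∀ α : ℝ, 1 + (((r - 1 : ℕ) : ℝ) - 1 / 8) / x ≤ α →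
      Real.log (1 + P * (2 * τ * x)) +
        (gammaTailMoment (r - 1) 1 x / (x + 1 / (2 * τ * P)) -
          gammaTailMoment (r - 1) 2 x / (2 * (x + 1 / (2 * τ * P)) ^ 2) +
          gammaTailMoment (r - 1) 3 x / (3 * (x + 1 / (2 * τ * P)) ^ 3)) /
            gammaTailMoment (r - 1) 0 x ≤
      Real.exp (-regGammaQ r x) * Real.log (1 + P * (2 * τ * x + 2 * α)) := by
  set n := r - 1 with hn
  -- This shift gives 1 + 2τPx = 2τP(x + b), so the logarithms are expanded in powers of 1/(x + b).
  set b : ℝ := 1 / (2 * τ * P) with hb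
  have hb0 : 0 < b := by positivity
  set D1 := gammaTailMoment n 1 1
  set D3 := gammaTailMoment n 3 1
  have hinv : Tendsto (fun x : ℝ => 1 / x) atTop (𝓝 0) :=
    tendsto_const_nhds.div_atTop tendsto_id
  have hc : Tendsto (fun x : ℝ => 1 + b * (1 / x)) atTop (𝓝 1) := by
    simpa using (hinv.const_mul b).const_add 1
  have hα : Tendsto (fun x : ℝ => 1 + ((n : ℝ) - 1 / 8) * (1 / x)) atTop (𝓝 1) := by
    simpa using (hinv.const_mul ((n : ℝ) - 1 / 8)).const_add 1
  have hI := tendsto_gammaTailMoment_zero n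
  have h1 : Tendsto (fun x : ℝ => (1 + b * (1 / x)) *
      (-(1 / 8) + (n * ((n : ℝ) - 1 / 8) - D1) * (1 / x))) atTop (𝓝 (-(1 / 8))) := by
    have := hc.mul ((hinv.const_mul (n * ((n : ℝ) - 1 / 8) - D1)).const_add (-(1 / 8)))
    rwa [mul_zero, add_zero, one_mul] at this
  have h2 : Tendsto (fun x : ℝ => gammaTailMoment n 0 x *
      ((1 + ((n : ℝ) - 1 / 8) * (1 / x)) ^ 2 / 2)) atTop (𝓝 (1 / 2)) := by
    simpa using hI.mul ((hα.pow 2).div_const 2)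
  have h3 : Tendsto (fun x : ℝ => gammaTailMoment n 0 x * ((1 + b * (1 / x)) ^ 2 * P *
      (2 + 2 * (1 + ((n : ℝ) - 1 / 8) * (1 / x)) * (1 / x)) * (x ^ 3 * regGammaQ r x))) atTop
      (𝓝 0) := by
    have := hI.mul ((((hc.pow 2).mul_const P).mul
      (((hα.const_mul 2).mul hinv).const_add 2)).mul (tendsto_pow_mul_regGammaQ hr 3))
    simpa using this
  have h4 : Tendsto (fun x : ℝ => D3 / 3 / (x + b)) atTop (𝓝 0) :=
    tendsto_const_nhds.div_atTop (tendsto_atTop_add_const_right _ _ tendsto_id)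
  -- A lower bound of the gap multiplied by (x + b)² and the zeroth tail moment. Its limit collects
  -- -1/8 from the error in α, -1/2 from the quadratic term of the logarithm on the right, 0 from
  -- the Poisson correction, +1 from the second moment of the excess and 0 from the cubic term: 3/8
  -- in all.
  have hG := ((h1.sub h2).sub h3).add (tendsto_const_nhds (x := (1 : ℝ))) |>.sub h4
  have hpos : (0 : ℝ) < -(1 / 8) - 1 / 2 - 0 + 1 - 0 := by norm_num
  filter_upwards [hG.eventually (eventually_gt_nhds hpos), eventually_ge_atTop 1]
    with x hx hx1 α hα'
  have hx0 : (0 : ℝ) < x := by positivity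
  set c := x + b with hcdef
  have hc0 : 0 < c := by positivity
  set β := 1 + ((n : ℝ) - 1 / 8) / x with hβ
  set I0 := gammaTailMoment n 0 x
  set I1 := gammaTailMoment n 1 x
  set I2 := gammaTailMoment n 2 x
  set I3 := gammaTailMoment n 3 x
  set p := regGammaQ r x
  have hI0 : 1 + (n : ℝ) / x ≤ I0 := by simpa using gammaTailMoment_ge n 0 hx0
  have hI0' : 0 < I0 := gammaTailMoment_pos n 0 hx0
  have hI1 : I1 ≤ 1 + 2 * n / x + D1 / x ^ 2 := by
    simpa [mul_comm] using gammaTailMoment_le n 1 hx1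
  have hI2 : 2 ≤ I2 := by simpa using factorial_le_gammaTailMoment n 2 hx0
  have hI3 : I3 ≤ D3 := gammaTailMoment_le_one n 3 hx1
  have hβ0 : 0 < β := by
    have h : β = (x + n - 1 / 8) / x := by rw [hβ]; field_simp; ring
    rw [h]
    have : (0 : ℝ) ≤ n := Nat.cast_nonneg n
    exact div_pos (by linarith) hx0
  have hp0 : 0 < p := regGammaQ_pos hr hx0
  set U := P * (2 * x + 2 * β) with hU
  clear_value I1 I2 I3 I0 p D1 D3
  have hT : 0 < I0 * (β * c - β ^ 2 / 2 - c ^ 2 * (p * U)) - (I1 * c - I2 / 2 + I3 / (3 * c)) := by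
    refine lt_of_lt_of_le hx ?_
    have e1 : (1 + b * (1 / x)) * (-(1 / 8) + (n * ((n : ℝ) - 1 / 8) - D1) * (1 / x)) =
        ((1 + (n : ℝ) / x) * β - (1 + 2 * n / x + D1 / x ^ 2)) * c := by
      rw [hβ, hcdef]; field_simp; ring
    have e2 : (1 + b * (1 / x)) ^ 2 * P * (2 + 2 * (1 + ((n : ℝ) - 1 / 8) * (1 / x)) * (1 / x)) *
        (x ^ 3 * p) = c ^ 2 * (p * U) := by
      rw [hU, hβ, hcdef]; field_simp
    have e3 : D3 / 3 / c = D3 / (3 * c) := by rw [div_div]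
    have e4 : 1 + ((n : ℝ) - 1 / 8) * (1 / x) = β := by rw [hβ]; ring
    rw [e1, e2, e3, e4]
    have f1 : ((1 + (n : ℝ) / x) * β - (1 + 2 * n / x + D1 / x ^ 2)) * c ≤
        (I0 * β - I1) * c := by gcongr
    have f3 : I3 / (3 * c) ≤ D3 / (3 * c) := by gcongr
    linarith
  have hS : (I1 / c - I2 / (2 * c ^ 2) + I3 / (3 * c ^ 3)) / I0 ≤
      β / c - (β / c) ^ 2 / 2 - p * U := by
    rw [div_le_iff₀ hI0']
    have e1 : I1 / c - I2 / (2 * c ^ 2) + I3 / (3 * c ^ 3) =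
        (I1 * c - I2 / 2 + I3 / (3 * c)) / c ^ 2 := by field_simp
    have e2 : (β / c - (β / c) ^ 2 / 2 - p * U) * I0 =
        I0 * (β * c - β ^ 2 / 2 - c ^ 2 * (p * U)) / c ^ 2 := by field_simp
    rw [e1, e2]
    gcongr
    linarith
  have hL0 : 1 + P * (2 * τ * x) = 2 * τ * P * c := by rw [hcdef, hb]; field_simp; ring
  have hcP : 0 < 2 * τ * P * c := by positivity
  set L := Real.log (1 + P * (2 * τ * x + 2 * β))
  have hLge : Real.log (1 + P * (2 * τ * x)) + (β / c - (β / c) ^ 2 / 2) ≤ L := by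
    -- Here τ ≤ 1 enters: the constant a is not scaled by τ, and 2τβ ≤ 2β.
    have h : (1 + P * (2 * τ * x)) * (1 + β / c) ≤ 1 + P * (2 * τ * x + 2 * β) := by
      have : (1 + P * (2 * τ * x)) * (1 + β / c) = 1 + P * (2 * τ * x) + 2 * τ * P * β := by
        rw [hL0]; field_simp
      rw [this]
      nlinarith [mul_nonneg (mul_nonneg hP.le hβ0.le) (sub_nonneg.2 hτ1)]
    have h0 : 0 ≤ β / c := by positivity
    calc _ ≤ Real.log (1 + P * (2 * τ * x)) + Real.log (1 + β / c) := by
          gcongr; exact le_log_one_add_quadratic h0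
      _ = Real.log ((1 + P * (2 * τ * x)) * (1 + β / c)) := by
          rw [Real.log_mul (by rw [hL0]; positivity) (by positivity)]
      _ ≤ L := Real.log_le_log (by rw [hL0]; positivity) h
  have hLle : L ≤ U := by
    have h : L ≤ 1 + P * (2 * τ * x + 2 * β) - 1 := Real.log_le_sub_one_of_pos (by positivity)
    refine h.trans ?_
    have hτx : τ * x ≤ x := mul_le_of_le_one_left hx0.le hτ1
    rw [hU, add_sub_cancel_left]
    exact mul_le_mul_of_nonneg_left (by linarith) hP.le
  have hL : 0 ≤ L := Real.log_nonneg (by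
    have : 0 ≤ P * (2 * τ * x + 2 * β) := by positivity
    linarith)
  have hexp := Real.add_one_le_exp (-p)
  have hpL := mul_le_mul_of_nonneg_left hLle hp0.le
  calc _ ≤ (1 - p) * L := by linarith
    _ ≤ Real.exp (-p) * L := mul_le_mul_of_nonneg_right (by linarith) hL
    _ ≤ _ := by
        refine mul_le_mul_of_nonneg_left (Real.log_le_log (by positivity) ?_) (Real.exp_pos _).le
        gcongr

/-- The mean of the squared norm of a channel vector whose squared norm exceeds `2τx`. -/
noncomputable def excessMean (n : ℕ) (τ x : ℝ) : ℝ :=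
  2 * τ * (x + gammaTailMoment n 1 x / gammaTailMoment n 0 x)

/-- The second moment of the squared norm of a channel vector whose squared norm exceeds `2τx`. -/
noncomputable def excessSecondMoment (n : ℕ) (τ x : ℝ) : ℝ :=
  (2 * τ) ^ 2 * (x ^ 2 + 2 * x * (gammaTailMoment n 1 x / gammaTailMoment n 0 x) +
    gammaTailMoment n 2 x / gammaTailMoment n 0 x)

/-- A bound of the mean SINR of one of `j` transmitting users whose squared norms have first two
moments `m₁` and `m₂`; here `t` is a free parameter. -/
noncomputable def sinrMeanBound (r j : ℕ) (m₁ m₂ t : ℝ) : ℝ :=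
  m₁ - (2 * t - t ^ 2) * ((j - 1) * m₁ ^ 2 / r) +
    t ^ 2 * ((j - 1) * (m₁ * m₂ / r) + (j - 1) * (j - 2) * (m₁ ^ 3 / r ^ 2))

lemma tendsto_excessMean (n : ℕ) {τ : ℝ} (hτ : 0 < τ) :
    Tendsto (fun x => excessMean n τ x / (2 * τ * x)) atTop (𝓝 1) := by
  have h := (tendsto_gammaTailMoment_div n 1 1 one_ne_zero).const_add 1
  rw [add_zero] at h
  refine h.congr' ?_
  filter_upwards [eventually_gt_atTop 0] with x hx
  unfold excessMean
  field_simp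

lemma tendsto_excessSecondMoment (n : ℕ) {τ : ℝ} (hτ : 0 < τ) :
    Tendsto (fun x => excessSecondMoment n τ x / (2 * τ * x) ^ 2) atTop (𝓝 1) := by
  have h := (((tendsto_gammaTailMoment_div n 1 1 one_ne_zero).const_mul 2).const_add 1).add
    (tendsto_gammaTailMoment_div n 2 2 two_ne_zero)
  rw [mul_zero, add_zero, add_zero] at h
  refine h.congr' ?_
  filter_upwards [eventually_gt_atTop 0] with x hx
  unfold excessSecondMoment
  field_simp

/-- With u = 2τx, t = β/u, m₁ ~ u and m₂ ~ u², the bound divided by u tends to 1 - 2β(j-1)/r +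
β²((j-1)/r + (j-1)(j-2)/r²), which is least at β = r/(r+j-2). The simpler β = r/(r+j) gives 1 -
(j-1)(r+j+2)/(r+j)². Replacing r+j+2 by r+j+1 leaves room for the limit, and the result is still
strictly below 1 - (j-1)/(r+j). -/
lemma eventually_sinrMeanBound_le {r j : ℕ} (hj : 2 ≤ j) (hjr : j ≤ r) {τ : ℝ} (hτ : 0 < τ) :
    ∀ᶠ x in atTop, sinrMeanBound r j (excessMean (r - 1) τ x) (excessSecondMoment (r - 1) τ x)
      (r / (r + j) / (2 * τ * x)) ≤
        (1 - (j - 1) * (r + j + 1) / (r + j) ^ 2) * (2 * τ * x) := by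
  have hr0 : (0 : ℝ) < r := by exact_mod_cast (by omega : 0 < r)
  have hj1 : (2 : ℝ) ≤ j := by exact_mod_cast hj
  set β : ℝ := r / (r + j) with hβ
  have h1 := tendsto_excessMean (r - 1) hτ
  have h2 := tendsto_excessSecondMoment (r - 1) hτ
  have h3 : Tendsto (fun x : ℝ => 1 / (2 * τ * x)) atTop (𝓝 0) :=
    tendsto_const_nhds.div_atTop (tendsto_id.const_mul_atTop (by positivity))
  have h := (h1.sub ((((h3.const_mul (β ^ 2)).const_sub (2 * β))).mul
    (((h1.pow 2).const_mul ((j : ℝ) - 1)).div_const r))).add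
    ((((h1.mul h2).div_const (r : ℝ)).const_mul ((j : ℝ) - 1)).add
      (((h1.pow 3).div_const ((r : ℝ) ^ 2)).const_mul (((j : ℝ) - 1) * (j - 2))) |>.const_mul (β ^ 2))
  have hlt : 1 - (2 * β - β ^ 2 * 0) * (((j : ℝ) - 1) * 1 ^ 2 / r) +
      β ^ 2 * (((j : ℝ) - 1) * (1 * 1 / r) + ((j : ℝ) - 1) * (j - 2) * (1 ^ 3 / r ^ 2)) <
      1 - (j - 1) * (r + j + 1) / (r + j) ^ 2 := by
    have e : 1 - (j - 1) * (r + j + 1) / (r + j) ^ 2 -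
      (1 - (2 * β - β ^ 2 * 0) * (((j : ℝ) - 1) * 1 ^ 2 / r) +
      β ^ 2 * (((j : ℝ) - 1) * (1 * 1 / r) + ((j : ℝ) - 1) * (j - 2) * (1 ^ 3 / r ^ 2))) =
      (j - 1) / (r + j) ^ 2 := by
      rw [hβ]; field_simp; ring
    have : 0 < ((j : ℝ) - 1) / (r + j) ^ 2 := div_pos (by linarith) (by positivity)
    linarith
  filter_upwards [h.eventually (eventually_lt_nhds hlt), eventually_gt_atTop 0] with x hx hx0
  have hu : 0 < 2 * τ * x := by positivity
  rw [← div_le_iff₀ hu]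
  refine le_of_eq_of_le ?_ hx.le
  unfold sinrMeanBound
  field_simp

/-- The two logarithms differ by log(e/d) > 0 in the limit, while the exponential factor costs at
most jp times a quantity linear in x, which tends to 0. -/
lemma eventually_log_le_exp_mul_log {r : ℕ} (hr : 1 ≤ r) (j : ℕ) {P τ d e : ℝ} (hP : 0 < P)
    (hτ : 0 < τ) (hd : 0 < d) (hde : d < e) : ∀ᶠ x in atTop,
      Real.log (1 + P * (d * (2 * τ * x))) ≤
        Real.exp (-(j * regGammaQ r x)) * Real.log (1 + P * (e * (2 * τ * x))) := by
  have he : 0 < e := hd.trans hde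
  have hinv : Tendsto (fun x : ℝ => 1 / x) atTop (𝓝 0) :=
    tendsto_const_nhds.div_atTop tendsto_id
  have h1 : Tendsto (fun x : ℝ => Real.log ((1 / x + P * (e * (2 * τ))) /
      (1 / x + P * (d * (2 * τ))))) atTop (𝓝 (Real.log (e / d))) := by
    have := ((hinv.add_const (P * (e * (2 * τ)))).div (hinv.add_const (P * (d * (2 * τ))))
      (by positivity)).log (by positivity)
    have e0 : (0 + P * (e * (2 * τ))) / (0 + P * (d * (2 * τ))) = e / d := by
      rw [zero_add, zero_add]; field_simp
    rwa [e0] at this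
  have h2 := ((tendsto_pow_mul_regGammaQ hr 1).const_mul (j * (P * (e * (2 * τ)))))
  have h3 := h1.sub h2
  have hpos : 0 < Real.log (e / d) - j * (P * (e * (2 * τ))) * 0 := by
    rw [mul_zero, sub_zero]; exact Real.log_pos (by rwa [one_lt_div hd])
  filter_upwards [h3.eventually (eventually_gt_nhds hpos), eventually_gt_atTop 0] with x hx hx0
  have hp := regGammaQ_pos hr hx0
  set p := regGammaQ r x
  have e1 : Real.log ((1 / x + P * (e * (2 * τ))) / (1 / x + P * (d * (2 * τ)))) =
      Real.log (1 + P * (e * (2 * τ * x))) - Real.log (1 + P * (d * (2 * τ * x))) := by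
    rw [← Real.log_div (by positivity) (by positivity)]
    congr 1
    field_simp
  rw [e1] at hx
  have hL : Real.log (1 + P * (e * (2 * τ * x))) ≤ P * (e * (2 * τ * x)) := by
    have := Real.log_le_sub_one_of_pos (x := 1 + P * (e * (2 * τ * x))) (by positivity)
    linarith
  have hL0 : 0 ≤ Real.log (1 + P * (e * (2 * τ * x))) := Real.log_nonneg (by
    have : 0 ≤ P * (e * (2 * τ * x)) := by positivity
    linarith)
  have hexp := Real.add_one_le_exp (-(j * p))
  have hjp : 0 ≤ j * p := by positivity
  calc _ ≤ (1 - j * p) * Real.log (1 + P * (e * (2 * τ * x))) := by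
        nlinarith [mul_le_mul_of_nonneg_left hL hjp]
    _ ≤ _ := by gcongr; linarith

/-! ### The MMSE quadratic form and polynomial bounds of the SINR -/

lemma star_dotProduct_self_eq {ι : Type*} [Fintype ι] (v : ι → ℂ) :
    star v ⬝ᵥ v = ((∑ n, ‖v n‖ ^ 2 : ℝ) : ℂ) := by
  simp only [dotProduct, Pi.star_apply, RCLike.star_def, Complex.conj_mul']
  push_cast
  rfl

lemma re_star_dotProduct_le {ι : Type*} [Fintype ι] (v w : ι → ℂ) :
    (star v ⬝ᵥ w).re ≤ ((∑ n, ‖v n‖ ^ 2) + ∑ n, ‖w n‖ ^ 2) / 2 := by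
  simp only [dotProduct, Pi.star_apply, RCLike.star_def, Complex.re_sum]
  rw [← Finset.sum_add_distrib, Finset.sum_div]
  refine Finset.sum_le_sum fun n _ => (Complex.re_le_norm _).trans ?_
  rw [norm_mul, RCLike.norm_conj]
  nlinarith [sq_nonneg (‖v n‖ - ‖w n‖)]

section MMSE

variable {m ι : Type*} [Fintype m] [Fintype ι] [DecidableEq m]

open scoped ComplexOrder in
lemma det_mul_conjTranspose_add_one_ne_zero (H : Matrix m ι ℂ) : (H * Hᴴ + 1).det ≠ 0 :=
  (Matrix.PosDef.posSemidef_add (Matrix.posSemidef_self_mul_conjTranspose H)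
    Matrix.PosDef.one).det_pos.ne'

/-- The MMSE quadratic form in terms of the filtered vector `v = (H Hᴴ + 1)⁻¹ g`. -/
lemma mmse_form_eq (H : Matrix m ι ℂ) (g : m → ℂ) :
    (star g ⬝ᵥ ((H * Hᴴ + 1)⁻¹ *ᵥ g)).re =
      ∑ n, ‖((H * Hᴴ + 1)⁻¹ *ᵥ g) n‖ ^ 2 + ∑ s, ‖(Hᴴ *ᵥ ((H * Hᴴ + 1)⁻¹ *ᵥ g)) s‖ ^ 2 := by
  have hdet : IsUnit (H * Hᴴ + 1).det :=
    isUnit_iff_ne_zero.2 (det_mul_conjTranspose_add_one_ne_zero H)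
  set v := (H * Hᴴ + 1)⁻¹ *ᵥ g with hv
  have hg : g = H *ᵥ (Hᴴ *ᵥ v) + v := by
    rw [Matrix.mulVec_mulVec, ← Matrix.one_mulVec v, Matrix.mulVec_mulVec, mul_one,
      ← Matrix.add_mulVec, hv, Matrix.mulVec_mulVec, Matrix.mul_nonsing_inv _ hdet,
      Matrix.one_mulVec]
  conv_lhs => rw [hg]
  rw [star_add, add_dotProduct, Matrix.star_mulVec, ← Matrix.dotProduct_mulVec,
    star_dotProduct_self_eq, star_dotProduct_self_eq, Complex.add_re, Complex.ofReal_re,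
    Complex.ofReal_re, add_comm]

/-- The MMSE quadratic form is the least regularized squared error. -/
lemma mmse_form_le (H : Matrix m ι ℂ) (g : m → ℂ) (w : ι → ℂ) :
    (star g ⬝ᵥ ((H * Hᴴ + 1)⁻¹ *ᵥ g)).re ≤
      ∑ n, ‖(g - H *ᵥ w) n‖ ^ 2 + ∑ s, ‖w s‖ ^ 2 := by
  have h1 := mmse_form_eq H g
  set v := (H * Hᴴ + 1)⁻¹ *ᵥ g
  -- Each product on the right is at most half a sum of squares. The squares of v and Hᴴv add up to
  -- the form itself, so half of the form is absorbed on the left.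
  have h2 : (star g ⬝ᵥ v).re = (star (g - H *ᵥ w) ⬝ᵥ v).re + (star w ⬝ᵥ (Hᴴ *ᵥ v)).re := by
    rw [Matrix.dotProduct_mulVec (star w), ← Matrix.star_mulVec, ← Complex.add_re, ← add_dotProduct,
      ← star_add, sub_add_cancel]
  have h3 := re_star_dotProduct_le (g - H *ᵥ w) v
  have h4 := re_star_dotProduct_le w (Hᴴ *ᵥ v)
  linarith

/-- The trial vector in the least-squares bound is t Hᴴg, a scaled matched filter. The inverse
matrix disappears, and what is left is polynomial in the entries, with a computable mean. -/
lemma mmse_form_le_quadratic (H : Matrix m ι ℂ) (g : m → ℂ) (t : ℝ) :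
    (star g ⬝ᵥ ((H * Hᴴ + 1)⁻¹ *ᵥ g)).re ≤
      ∑ n, ‖g n‖ ^ 2 - (2 * t - t ^ 2) * ∑ s, ‖(Hᴴ *ᵥ g) s‖ ^ 2 +
        t ^ 2 * ∑ n, ‖(H *ᵥ (Hᴴ *ᵥ g)) n‖ ^ 2 := by
  refine (mmse_form_le H g ((t : ℂ) • (Hᴴ *ᵥ g))).trans (le_of_eq ?_)
  set z := Hᴴ *ᵥ g with hz
  have hzz : star (H *ᵥ z) ⬝ᵥ g = star z ⬝ᵥ z := by
    rw [Matrix.star_mulVec, ← Matrix.dotProduct_mulVec]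
  have hzz' : star g ⬝ᵥ (H *ᵥ z) = star z ⬝ᵥ z := by
    rw [Matrix.dotProduct_mulVec, ← Matrix.conjTranspose_conjTranspose H, ← Matrix.star_mulVec]
  have h : ((∑ n, ‖(g - H *ᵥ ((t : ℂ) • z)) n‖ ^ 2 + ∑ s, ‖((t : ℂ) • z) s‖ ^ 2 : ℝ) : ℂ) =
      ((∑ n, ‖g n‖ ^ 2 - (2 * t - t ^ 2) * ∑ s, ‖z s‖ ^ 2 +
        t ^ 2 * ∑ n, ‖(H *ᵥ z) n‖ ^ 2 : ℝ) : ℂ) := by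
    simp only [Complex.ofReal_add, Complex.ofReal_sub, Complex.ofReal_mul,
      ← star_dotProduct_self_eq]
    simp only [Matrix.mulVec_smul, star_sub, star_smul, sub_dotProduct, dotProduct_sub,
      smul_dotProduct, dotProduct_smul, hzz, hzz', RCLike.star_def, Complex.conj_ofReal,
      smul_eq_mul]
    push_cast
    ring
  exact_mod_cast h

end MMSE

section SINR

variable {K r : ℕ}

lemma mmseSINR_nonneg (S : Finset (Fin K)) (h : Fin K → Fin r → ℂ) (i : Fin K) :
    0 ≤ mmseSINR S h i := by
  unfold mmseSINR mmseMatrix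
  rw [mmse_form_eq]
  positivity

lemma mmseSINR_le_channelGain (S : Finset (Fin K)) (h : Fin K → Fin r → ℂ) (i : Fin K) :
    mmseSINR S h i ≤ channelGain (h i) := by
  refine (mmse_form_le_quadratic (channelMatrix (S.erase i) h) (h i) 0).trans (le_of_eq ?_)
  simp [channelGain]

/-- The correlation of two channel vectors. -/
noncomputable def channelInner (v w : Fin r → ℂ) : ℂ := ∑ a, conj (v a) * w a

lemma mmseSINR_le (S : Finset (Fin K)) (h : Fin K → Fin r → ℂ) (i : Fin K) (t : ℝ) :
    mmseSINR S h i ≤ channelGain (h i) -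
      (2 * t - t ^ 2) * ∑ s ∈ S.erase i, ‖channelInner (h s) (h i)‖ ^ 2 +
        t ^ 2 * ∑ n, ‖∑ s ∈ S.erase i, h s n * channelInner (h s) (h i)‖ ^ 2 := by
  refine (mmse_form_le_quadratic (channelMatrix (S.erase i) h) (h i) t).trans (le_of_eq ?_)
  have hz : ∀ s : S.erase i, ((channelMatrix (S.erase i) h)ᴴ *ᵥ h i) s =
      channelInner (h s) (h i) := fun s => rfl
  have hw : ∀ n, (channelMatrix (S.erase i) h *ᵥ ((channelMatrix (S.erase i) h)ᴴ *ᵥ h i)) n =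
      ∑ s ∈ S.erase i, h s n * channelInner (h s) (h i) := fun n => by
    rw [← Finset.sum_coe_sort]; rfl
  simp only [hz, hw]
  rw [Finset.sum_coe_sort (S.erase i) fun s => ‖channelInner (h s) (h i)‖ ^ 2]
  rfl

lemma measurable_mmseSINR (S : Finset (Fin K)) (i : Fin K) :
    Measurable fun h : Fin K → Fin r → ℂ => mmseSINR S h i := by
  have hH : Continuous fun h : Fin K → Fin r → ℂ =>
      channelMatrix (S.erase i) h * (channelMatrix (S.erase i) h)ᴴ + 1 := by
    have : Continuous fun h : Fin K → Fin r → ℂ => channelMatrix (S.erase i) h :=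
      continuous_matrix fun n s => by unfold channelMatrix; simp only [Matrix.of_apply]; fun_prop
    exact (this.matrix_mul this.matrix_conjTranspose).add continuous_const
  refine Continuous.measurable ?_
  unfold mmseSINR mmseMatrix
  -- The inverse is the adjugate over a determinant that never vanishes, so the SINR is continuous.
  simp only [Matrix.inv_def, Ring.inverse_eq_inv']
  refine Complex.continuous_re.comp (Continuous.dotProduct (by fun_prop) ?_)
  refine Continuous.matrix_mulVec (Continuous.smul (Continuous.inv₀ hH.matrix_det fun h => ?_)
    hH.matrix_adjugate) (by fun_prop)
  exact det_mul_conjTranspose_add_one_ne_zero (channelMatrix (S.erase i) h)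

end SINR

/-! ### Mean of the SINR bound for independent isotropic vectors -/

/-- `f` is integrable with integral `c`. -/
def HasMean {Ω E : Type*} [MeasurableSpace Ω] [NormedAddCommGroup E] [NormedSpace ℝ E]
    (f : Ω → E) (μ : Measure Ω) (c : E) : Prop :=
  Integrable f μ ∧ ∫ ω, f ω ∂μ = c

namespace HasMean

section

variable {Ω E : Type*} [MeasurableSpace Ω] [NormedAddCommGroup E] [NormedSpace ℝ E]
  {μ : Measure Ω}

lemma add {f g : Ω → E} {c d : E} (hf : HasMean f μ c) (hg : HasMean g μ d) :
    HasMean (fun ω => f ω + g ω) μ (c + d) :=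
  ⟨hf.1.add hg.1, by rw [integral_add hf.1 hg.1, hf.2, hg.2]⟩

lemma sub {f g : Ω → E} {c d : E} (hf : HasMean f μ c) (hg : HasMean g μ d) :
    HasMean (fun ω => f ω - g ω) μ (c - d) :=
  ⟨hf.1.sub hg.1, by rw [integral_sub hf.1 hg.1, hf.2, hg.2]⟩

lemma sum {ι : Type*} (s : Finset ι) {f : ι → Ω → E} {c : ι → E}
    (h : ∀ i ∈ s, HasMean (f i) μ (c i)) :
    HasMean (fun ω => ∑ i ∈ s, f i ω) μ (∑ i ∈ s, c i) :=
  ⟨integrable_finsetSum s fun i hi => (h i hi).1, by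
    rw [integral_finsetSum s fun i hi => (h i hi).1]
    exact Finset.sum_congr rfl fun i hi => (h i hi).2⟩

lemma const_mul {f : Ω → ℝ} {c : ℝ} (h : HasMean f μ c) (a : ℝ) :
    HasMean (fun ω => a * f ω) μ (a * c) :=
  ⟨h.1.const_mul a, by rw [integral_const_mul, h.2]⟩

lemma of_ofReal {f : Ω → ℝ} {c : ℝ} (h : HasMean (fun ω => (f ω : ℂ)) μ (c : ℂ)) :
    HasMean f μ c := by
  refine ⟨by simpa using h.1.re, ?_⟩
  have : ∫ ω, (f ω : ℂ) ∂μ = c := h.2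
  rw [integral_complex_ofReal] at this
  exact_mod_cast this

lemma congr {f g : Ω → E} {c d : E} (h : HasMean f μ c) (hfg : ∀ ω, g ω = f ω) (hcd : d = c) :
    HasMean g μ d := by
  rw [hcd, funext hfg]; exact h

end

section

variable {ι Ω : Type*} [Fintype ι] [DecidableEq ι] [MeasurableSpace Ω] {ν : ι → Measure Ω}
  [∀ i, IsProbabilityMeasure (ν i)]

/-- Independence: the product is padded with the factor 1 at the indices outside a. -/
lemma finset_prod (a : Finset ι) {f : ι → Ω → ℂ} {c : ι → ℂ}
    (h : ∀ i ∈ a, HasMean (f i) (ν i) (c i)) :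
    HasMean (fun ω : ι → Ω => ∏ i ∈ a, f i (ω i)) (Measure.pi ν) (∏ i ∈ a, c i) := by
  let F : ι → Ω → ℂ := fun i x => if i ∈ a then f i x else 1
  have hF : ∀ i, HasMean (F i) (ν i) (if i ∈ a then c i else 1) := by
    intro i
    by_cases hi : i ∈ a
    · simpa [F, hi] using h i hi
    · simp [F, hi, HasMean]
  have h1 : ∀ ω : ι → Ω, ∏ i ∈ a, f i (ω i) = ∏ i, F i (ω i) := fun ω => by
    simp [F, Finset.prod_ite_mem]
  refine HasMean.congr ⟨Integrable.fintype_prod fun i => (hF i).1, ?_⟩ h1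
    (d := ∏ i ∈ a, c i) (c := ∏ i, if i ∈ a then c i else 1) (by simp [Finset.prod_ite_mem])
  rw [integral_fintype_prod_eq_prod]
  exact Finset.prod_congr rfl fun i _ => (hF i).2

lemma pair {i s : ι} (his : i ≠ s) {f g : Ω → ℂ} {c d : ℂ} (hf : HasMean f (ν i) c)
    (hg : HasMean g (ν s) d) :
    HasMean (fun ω : ι → Ω => f (ω i) * g (ω s)) (Measure.pi ν) (c * d) := by
  have := finset_prod (ν := ν) {i, s} (f := fun m => if m = i then f else g)
    (c := fun m => if m = i then c else d) (by
      intro m hm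
      rcases Finset.mem_insert.1 hm with rfl | hm
      · simpa using hf
      · obtain rfl := Finset.mem_singleton.1 hm
        simpa [his.symm] using hg)
  simpa [Finset.prod_pair his, his.symm] using this

lemma triple {i s s' : ι} (his : i ≠ s) (his' : i ≠ s') (hss' : s ≠ s') {f g k : Ω → ℂ}
    {c d e : ℂ} (hf : HasMean f (ν i) c) (hg : HasMean g (ν s) d) (hk : HasMean k (ν s') e) :
    HasMean (fun ω : ι → Ω => f (ω i) * (g (ω s) * k (ω s'))) (Measure.pi ν) (c * (d * e)) := by
  have := finset_prod (ν := ν) {i, s, s'}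
    (f := fun m => if m = i then f else if m = s then g else k)
    (c := fun m => if m = i then c else if m = s then d else e) (by
      intro m hm
      rcases Finset.mem_insert.1 hm with rfl | hm
      · simpa using hf
      rcases Finset.mem_insert.1 hm with rfl | hm
      · simpa [his.symm] using hg
      · obtain rfl := Finset.mem_singleton.1 hm
        simpa [his'.symm, hss'.symm] using hk)
  simpa [Finset.prod_insert, his, his', hss', his.symm, his'.symm, hss'.symm] using this

end

end HasMean

/-- The factors are grouped by vector, so that `HasMean.pair` applies term by term. -/
lemma normSq_channelInner {r : ℕ} (v w : Fin r → ℂ) : ((‖channelInner v w‖ ^ 2 : ℝ) : ℂ) =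
    ∑ a, ∑ b, (conj (w a) * w b) * (conj (v b) * v a) := by
  push_cast
  rw [← Complex.conj_mul', channelInner, map_sum, Finset.sum_mul_sum]
  refine Finset.sum_congr rfl fun a _ => Finset.sum_congr rfl fun b _ => ?_
  simp only [map_mul, Complex.conj_conj]
  ring

lemma normSq_sum_channelInner {K r : ℕ} (T : Finset (Fin K)) (h : Fin K → Fin r → ℂ)
    (g : Fin r → ℂ) :
    ((∑ n, ‖∑ s ∈ T, h s n * channelInner (h s) g‖ ^ 2 : ℝ) : ℂ) =
      ∑ s ∈ T, ∑ s' ∈ T, ∑ n, ∑ a, ∑ b, (conj (g a) * g b) *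
        ((conj (h s n) * h s a) * (conj (h s' b) * h s' n)) := by
  push_cast
  simp only [← Complex.conj_mul', map_sum, Finset.sum_mul_sum]
  rw [Finset.sum_comm]
  refine Finset.sum_congr rfl fun s _ => ?_
  rw [Finset.sum_comm]
  refine Finset.sum_congr rfl fun s' _ => Finset.sum_congr rfl fun n _ => ?_
  rw [map_mul, mul_mul_mul_comm, channelInner, channelInner, map_sum, Finset.sum_mul_sum,
    Finset.mul_sum]
  refine Finset.sum_congr rfl fun a _ => ?_
  rw [Finset.mul_sum]
  refine Finset.sum_congr rfl fun b _ => ?_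
  simp only [map_mul, Complex.conj_conj]
  ring

lemma ofReal_channelGain {r : ℕ} (v : Fin r → ℂ) :
    (channelGain v : ℂ) = ∑ a, conj (v a) * v a := by
  simp only [channelGain, Complex.conj_mul']
  push_cast
  rfl

/-- The mean of the quadratic bound of the SINR for independent isotropic channel vectors. -/
lemma hasMean_sinr_bound {K r : ℕ} {ν : Fin K → Measure (Fin r → ℂ)}
    [∀ i, IsProbabilityMeasure (ν i)] {T : Finset (Fin K)} {i : Fin K} (hi : i ∈ T) {c₁ c₂ : ℝ}
    (h₁ : ∀ s ∈ T, ∀ a b, HasMean (fun v : Fin r → ℂ => conj (v a) * v b) (ν s)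
      (if a = b then (c₁ : ℂ) else 0))
    (h₂ : ∀ s ∈ T, ∀ a b, HasMean (fun v : Fin r → ℂ => (channelGain v : ℂ) * (conj (v a) * v b))
      (ν s) (if a = b then (c₂ : ℂ) else 0)) (t : ℝ) :
    HasMean (fun h : Fin K → Fin r → ℂ => channelGain (h i) -
      (2 * t - t ^ 2) * ∑ s ∈ T.erase i, ‖channelInner (h s) (h i)‖ ^ 2 +
        t ^ 2 * ∑ n, ‖∑ s ∈ T.erase i, h s n * channelInner (h s) (h i)‖ ^ 2) (Measure.pi ν)
      (r * c₁ - (2 * t - t ^ 2) * ((T.card - 1) * (r * c₁ ^ 2)) +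
        t ^ 2 * ((T.card - 1) * (r * c₁ * c₂) + (T.card - 1) * (T.card - 2) * (r * c₁ ^ 3))) := by
  have hcard : (((T.erase i).card : ℕ) : ℝ) = T.card - 1 := by
    rw [Finset.card_erase_of_mem hi, Nat.cast_sub (Finset.card_pos.2 ⟨i, hi⟩), Nat.cast_one]
  have hmem : ∀ s ∈ T.erase i, i ≠ s ∧ s ∈ T := fun s hs =>
    ⟨(Finset.ne_of_mem_erase hs).symm, Finset.mem_of_mem_erase hs⟩
  have hA : HasMean (fun h : Fin K → Fin r → ℂ => channelGain (h i)) (Measure.pi ν) (r * c₁) := by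
    refine HasMean.of_ofReal ?_
    have := HasMean.sum (μ := Measure.pi ν) (Finset.univ : Finset (Fin r)) fun a _ =>
      HasMean.finset_prod (ν := ν) {i} (f := fun _ (v : Fin r → ℂ) => conj (v a) * v a)
        (c := fun _ => (c₁ : ℂ)) (by
          intro m hm
          rw [Finset.mem_singleton.1 hm]
          simpa using h₁ i hi a a)
    exact this.congr (fun h => by simp [ofReal_channelGain]) (by simp)
  have hB : HasMean (fun h : Fin K → Fin r → ℂ =>
      ∑ s ∈ T.erase i, ‖channelInner (h s) (h i)‖ ^ 2) (Measure.pi ν)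
      ((T.card - 1) * (r * c₁ ^ 2)) := by
    have : ∀ s ∈ T.erase i, HasMean (fun h : Fin K → Fin r → ℂ =>
        ‖channelInner (h s) (h i)‖ ^ 2) (Measure.pi ν) (r * c₁ ^ 2) := by
      intro s hs
      obtain ⟨his, hsT⟩ := hmem s hs
      refine HasMean.of_ofReal ?_
      have := HasMean.sum (μ := Measure.pi ν) Finset.univ fun a _ =>
        HasMean.sum Finset.univ fun b _ => HasMean.pair (ν := ν) his (h₁ i hi a b) (h₁ s hsT b a)
      refine this.congr (fun h => normSq_channelInner _ _) ?_
      simp [sq]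
    exact (HasMean.sum _ this).congr (fun _ => rfl) (by
      rw [Finset.sum_const, nsmul_eq_mul, hcard])
  have hC : HasMean (fun h : Fin K → Fin r → ℂ =>
      ∑ n, ‖∑ s ∈ T.erase i, h s n * channelInner (h s) (h i)‖ ^ 2) (Measure.pi ν)
      ((T.card - 1) * (r * c₁ * c₂) + (T.card - 1) * (T.card - 2) * (r * c₁ ^ 3)) := by
    refine HasMean.of_ofReal ?_
    have : ∀ s ∈ T.erase i, ∀ s' ∈ T.erase i, HasMean (fun h : Fin K → Fin r → ℂ =>
        ∑ n, ∑ a, ∑ b, (conj (h i a) * h i b) *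
        ((conj (h s n) * h s a) * (conj (h s' b) * h s' n))) (Measure.pi ν)
        (if s = s' then (r * c₁ * c₂ : ℂ) else r * c₁ ^ 3) := by
      intro s hs s' hs'
      obtain ⟨his, hsT⟩ := hmem s hs
      obtain ⟨his', hsT'⟩ := hmem s' hs'
      -- On the diagonal, summing over n produces the gain of the vector of s and so the moment c₂.
      -- Off it, three independent vectors give Kronecker deltas forcing n = a = b, which leaves r
      -- c₁³.
      by_cases hss : s = s'
      · subst hss
        have := HasMean.sum (μ := Measure.pi ν) Finset.univ fun a _ =>
          HasMean.sum Finset.univ fun b _ =>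
            HasMean.pair (ν := ν) his (h₁ i hi a b) (h₂ s hsT b a)
        refine this.congr (fun h => ?_) ?_
        · rw [Finset.sum_comm]
          refine Finset.sum_congr rfl fun a _ => ?_
          rw [Finset.sum_comm]
          refine Finset.sum_congr rfl fun b _ => ?_
          rw [ofReal_channelGain, Finset.sum_mul, Finset.mul_sum]
          exact Finset.sum_congr rfl fun n _ => by ring
        · simp [mul_assoc]
      · have := HasMean.sum (μ := Measure.pi ν) Finset.univ fun n _ =>
          HasMean.sum Finset.univ fun a _ => HasMean.sum Finset.univ fun b _ =>
            HasMean.triple (ν := ν) his his' hss (h₁ i hi a b) (h₁ s hsT n a) (h₁ s' hsT' b n)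
        refine this.congr (fun h => rfl) ?_
        simp [hss, pow_succ, mul_assoc]
    refine (HasMean.sum _ fun s hs => HasMean.sum _ fun s' hs' => this s hs s' hs').congr
      (fun h => normSq_sum_channelInner _ _ _) ?_
    have hs : ∀ s ∈ T.erase i, ∑ s' ∈ T.erase i,
        (if s = s' then (r * c₁ * c₂ : ℂ) else r * c₁ ^ 3) =
        r * c₁ * c₂ + ((T.card : ℂ) - 2) * (r * c₁ ^ 3) := by
      intro s hs
      have h1 : ∀ s' ∈ T.erase i, (if s = s' then (r * c₁ * c₂ : ℂ) else r * c₁ ^ 3) =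
          (if s = s' then (r * c₁ * c₂ - r * c₁ ^ 3 : ℂ) else 0) + r * c₁ ^ 3 := by
        intro s' _; split_ifs <;> ring
      have hcard' : (((T.erase i).card : ℕ) : ℂ) = T.card - 1 := by exact_mod_cast hcard
      rw [Finset.sum_congr rfl h1, Finset.sum_add_distrib, Finset.sum_ite_eq, if_pos hs,
        Finset.sum_const, nsmul_eq_mul, hcard']
      ring
    have hcard' : (((T.erase i).card : ℕ) : ℂ) = T.card - 1 := by exact_mod_cast hcard
    rw [Finset.sum_congr rfl hs, Finset.sum_const, nsmul_eq_mul, hcard']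
    push_cast
    ring
  exact (hA.sub (hB.const_mul _)).add (hC.const_mul _)

/-! ### Isotropy of the Gaussian vector -/

lemma measurePreserving_neg_complexGaussian {τ : ℝ≥0} (hτ : τ ≠ 0) :
    MeasurePreserving (fun z : ℂ => -z) (complexGaussian τ) (complexGaussian τ) := by
  refine ⟨measurable_neg, ?_⟩
  ext s hs
  rw [Measure.map_apply measurable_neg hs, complexGaussian_eq_withDensity hτ,
    withDensity_apply _ (measurable_neg hs), withDensity_apply _ hs,
    ← (Measure.measurePreserving_neg (volume : Measure ℂ)).setLIntegral_comp_preimage hs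
      (continuous_complexGaussianPDF τ).measurable.ennreal_ofReal]
  simp [complexGaussianPDF]

section Isotropy

variable {r : ℕ}

/-- The sign flip of one coordinate. -/
def flipCoord (a : Fin r) (v : Fin r → ℂ) : Fin r → ℂ := fun n => if n = a then -v n else v n

lemma channelGain_flipCoord (a : Fin r) (v : Fin r → ℂ) :
    channelGain (flipCoord a v) = channelGain v := by
  unfold channelGain flipCoord
  refine Finset.sum_congr rfl fun n _ => ?_
  split_ifs <;> simp

lemma measurePreserving_flipCoord {τ : ℝ≥0} (hτ : τ ≠ 0) (a : Fin r) :
    MeasurePreserving (flipCoord a) (userLaw r τ) (userLaw r τ) := by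
  refine measurePreserving_pi (fun _ => complexGaussian τ) (fun _ => complexGaussian τ)
    (f := fun n z => if n = a then -z else z) fun n => ?_
  by_cases h : n = a
  · simpa [h] using measurePreserving_neg_complexGaussian hτ
  · simpa [h] using! MeasurePreserving.id (complexGaussian τ)

lemma measurableEmbedding_flipCoord (a : Fin r) : MeasurableEmbedding (flipCoord a) :=
  (MeasurableEquiv.ofInvolutive (flipCoord a)
    (fun v => by ext n; unfold flipCoord; split_ifs <;> simp)
    (measurable_pi_lambda _ fun n => by
      unfold flipCoord; split_ifs <;> fun_prop)).measurableEmbedding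

lemma measurePreserving_comp_perm (τ : ℝ≥0) (σ : Equiv.Perm (Fin r)) :
    MeasurePreserving (MeasurableEquiv.piCongrLeft (fun _ => ℂ) σ) (userLaw r τ) (userLaw r τ) :=
  measurePreserving_piCongrLeft (fun _ => complexGaussian τ) σ

/-- Weighted by a function of its norm, a Gaussian vector is isotropic. -/
lemma hasMean_weighted_coord_mul {τ : ℝ≥0} (hτ : τ ≠ 0) {w : ℝ → ℝ} (hw : Measurable w)
    (hi : Integrable (fun v => w (channelGain v) * channelGain v) (userLaw r τ)) (a b : Fin r) :
    HasMean (fun v : Fin r → ℂ => (w (channelGain v) : ℂ) * (conj (v a) * v b)) (userLaw r τ)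
      (if a = b then
        ((∫ v, w (channelGain v) * channelGain v ∂(userLaw r τ)) / r : ℂ) else 0) := by
  have hint : ∀ a b : Fin r, Integrable
      (fun v : Fin r → ℂ => (w (channelGain v) : ℂ) * (conj (v a) * v b)) (userLaw r τ) := by
    intro a b
    have hm : Measurable fun v : Fin r → ℂ => (w (channelGain v) : ℂ) * (conj (v a) * v b) := by
      refine (Complex.measurable_ofReal.comp
        (hw.comp continuous_channelGain.measurable)).mul (Continuous.measurable ?_)
      have := Complex.continuous_conj
      fun_prop
    refine hi.mono hm.aestronglyMeasurable (.of_forall fun v => ?_)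
    rw [norm_mul, norm_mul, norm_mul, Complex.norm_real, RCLike.norm_conj]
    refine mul_le_mul_of_nonneg_left ?_ (norm_nonneg _)
    rw [Real.norm_of_nonneg (channelGain_nonneg v)]
    have h1 : ∀ c : Fin r, ‖v c‖ ^ 2 ≤ channelGain v := fun c =>
      Finset.single_le_sum (f := fun n => ‖v n‖ ^ 2) (fun _ _ => by positivity)
        (Finset.mem_univ c)
    nlinarith [h1 a, h1 b, sq_nonneg (‖v a‖ - ‖v b‖)]
  refine ⟨hint a b, ?_⟩
  split_ifs with hab
  · subst hab
    -- Swapping two coordinates preserves the law and the gain, so all r diagonal moments are equal,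
    -- and they add up to the weighted mean gain.
    have hsymm : ∀ b : Fin r,
        ∫ v : Fin r → ℂ, (w (channelGain v) : ℂ) * (conj (v b) * v b) ∂(userLaw r τ) =
        ∫ v : Fin r → ℂ, (w (channelGain v) : ℂ) * (conj (v a) * v a) ∂(userLaw r τ) := by
      intro b
      let σ : Equiv.Perm (Fin r) := Equiv.swap a b
      rw [← (measurePreserving_comp_perm τ σ).integral_comp'
        (fun v : Fin r → ℂ => (w (channelGain v) : ℂ) * (conj (v b) * v b))]
      refine integral_congr_ae (.of_forall fun v => ?_)
      have hv : ∀ n, MeasurableEquiv.piCongrLeft (fun _ => ℂ) σ v n = v (σ.symm n) := fun n => by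
        conv_lhs => rw [← σ.apply_symm_apply n]
        exact Equiv.piCongrLeft_apply_apply (fun _ => ℂ) σ v _
      have hg : channelGain (MeasurableEquiv.piCongrLeft (fun _ => ℂ) σ v) = channelGain v := by
        simp only [channelGain, hv]
        exact Equiv.sum_comp σ.symm fun n => ‖v n‖ ^ 2
      simp only [hg, hv]
      simp [σ]
    have hsum : ∑ b : Fin r,
        ∫ v : Fin r → ℂ, (w (channelGain v) : ℂ) * (conj (v b) * v b) ∂(userLaw r τ) =
        ((∫ v, w (channelGain v) * channelGain v ∂(userLaw r τ) : ℝ) : ℂ) := by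
      rw [← integral_finsetSum _ fun b _ => hint b b, ← integral_complex_ofReal]
      refine integral_congr_ae (.of_forall fun v => ?_)
      simp only [Complex.ofReal_mul, ofReal_channelGain, Finset.mul_sum]
    have hr : (r : ℂ) ≠ 0 := by
      have := a.pos
      exact_mod_cast this.ne'
    rw [Finset.sum_congr rfl fun b _ => hsymm b, Finset.sum_const, Finset.card_univ,
      Fintype.card_fin, nsmul_eq_mul] at hsum
    rw [eq_div_iff hr, mul_comm, hsum]
  -- Flipping the sign of coordinate a preserves law and gain but negates the integrand, so the
  -- integral is its own negative.
  · have h := (measurePreserving_flipCoord hτ a).integral_comp (measurableEmbedding_flipCoord a)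
      (fun v : Fin r → ℂ => (w (channelGain v) : ℂ) * (conj (v a) * v b))
    simp only [channelGain_flipCoord] at h
    simp only [flipCoord, if_true, if_neg (Ne.symm hab), map_neg, neg_mul, mul_neg,
      integral_neg] at h
    exact self_eq_neg.1 h.symm

end Isotropy

/-! ### The law of a vector conditioned on exceeding the threshold -/

lemma HasMean.cond {Ω E : Type*} [MeasurableSpace Ω] [NormedAddCommGroup E] [NormedSpace ℝ E]
    {μ : Measure Ω} {s : Set Ω} (hs : MeasurableSet s) (hs0 : μ s ≠ 0)
    {f : Ω → E} {c : E} (h : HasMean (s.indicator f) μ c) :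
    HasMean f (ProbabilityTheory.cond μ s) ((μ.real s)⁻¹ • c) := by
  obtain ⟨h1, h2⟩ := h
  rw [integral_indicator hs] at h2
  rw [integrable_indicator_iff hs] at h1
  refine ⟨h1.smul_measure (ENNReal.inv_ne_top.2 hs0), ?_⟩
  rw [ProbabilityTheory.cond, integral_smul_measure, h2, ENNReal.toReal_inv, measureReal_def]

/-- The event that the squared norm of a channel vector exceeds `u`. -/
def exceedSet (r : ℕ) (u : ℝ) : Set (Fin r → ℂ) := {v | u < channelGain v}

lemma measurableSet_exceedSet (r : ℕ) (u : ℝ) : MeasurableSet (exceedSet r u) :=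
  measurableSet_lt measurable_const continuous_channelGain.measurable

/-- The law of the channel vector of a transmitting user. -/
noncomputable def exceedLaw (r : ℕ) (τ : ℝ≥0) (u : ℝ) : Measure (Fin r → ℂ) :=
  ProbabilityTheory.cond (userLaw r τ) (exceedSet r u)

section Exceed

variable {r : ℕ} (hr : 1 ≤ r) {τ : ℝ≥0} (hτ : 0 < τ) {x : ℝ} (hx : 0 < x)
include hr hτ hx

lemma setIntegral_exceedSet (g : ℝ → ℝ) :
    ∫ v in exceedSet r (2 * τ * x), g (channelGain v) ∂(userLaw r τ) =
      x ^ (r - 1) * Real.exp (-x) / ((r - 1)! : ℝ) *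
        ∫ t in Set.Ioi (0 : ℝ), g (2 * τ * (x + t)) *
          ((1 + t / x) ^ (r - 1) * Real.exp (-t)) := by
  have hτ' : (0 : ℝ) < 2 * τ := by positivity
  rw [← integral_indicator (measurableSet_exceedSet _ _)]
  have h1 : ∀ v : Fin r → ℂ, (exceedSet r (2 * τ * x)).indicator (fun v => g (channelGain v)) v =
      (Set.Ioi (2 * τ * x)).indicator g (channelGain v) := fun v => rfl
  simp_rw [h1]
  rw [integral_comp_channelGain_userLaw hr hτ]
  have h2 : ∫ s in Set.Ioi (0 : ℝ), s ^ (r - 1) * Real.exp (-s) *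
      (Set.Ioi (2 * τ * x)).indicator g (2 * τ * s) =
      ∫ s in Set.Ioi x, s ^ (r - 1) * Real.exp (-s) * g (2 * τ * s) := by
    rw [← integral_indicator measurableSet_Ioi, ← integral_indicator measurableSet_Ioi]
    refine integral_congr_ae (.of_forall fun s => ?_)
    simp only [Set.indicator, Set.mem_Ioi, mul_lt_mul_iff_right₀ hτ']
    by_cases hs : x < s
    · simp [hs, hx.trans hs]
    · simp [hs]
  rw [h2, setIntegral_Ioi_gamma _ (fun s => g (2 * τ * s)) hx]
  ring

lemma measureReal_exceedSet :
    (userLaw r τ).real (exceedSet r (2 * τ * x)) = regGammaQ r x := by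
  have h := setIntegral_exceedSet hr hτ hx fun _ => 1
  simp only [integral_const, smul_eq_mul, mul_one, one_mul,
    MeasurableSet.univ, measureReal_restrict_apply, Set.univ_inter] at h
  rw [h, regGammaQ_eq hr hx, gammaTailMoment]
  simp only [pow_zero, one_mul]
  ring

lemma measure_exceedSet_ne_zero : userLaw r τ (exceedSet r (2 * τ * x)) ≠ 0 := by
  intro h
  have h1 := measureReal_exceedSet hr hτ hx
  rw [measureReal_def, h, ENNReal.toReal_zero] at h1
  exact (regGammaQ_pos hr hx).ne h1

lemma integral_exceedLaw (g : ℝ → ℝ) :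
    ∫ v, g (channelGain v) ∂(exceedLaw r τ (2 * τ * x)) =
      (∫ t in Set.Ioi (0 : ℝ), g (2 * τ * (x + t)) * ((1 + t / x) ^ (r - 1) * Real.exp (-t))) /
        gammaTailMoment (r - 1) 0 x := by
  rw [exceedLaw, ProbabilityTheory.cond, integral_smul_measure, ENNReal.toReal_inv,
    ← measureReal_def, measureReal_exceedSet hr hτ hx, setIntegral_exceedSet hr hτ hx,
    regGammaQ_eq hr hx, smul_eq_mul]
  have := gammaTailMoment_pos (r - 1) 0 hx
  field_simp

lemma integrable_channelGain_pow_exceedLaw (l : ℕ) :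
    Integrable (fun v => channelGain v ^ l) (exceedLaw r τ (2 * τ * x)) :=
  ((integrable_channelGain_pow hr hτ l).restrict).smul_measure
    (ENNReal.inv_ne_top.2 (measure_exceedSet_ne_zero hr hτ hx))

lemma integral_channelGain_exceedLaw :
    ∫ v, channelGain v ∂(exceedLaw r τ (2 * τ * x)) = excessMean (r - 1) τ x := by
  rw [integral_exceedLaw hr hτ hx fun y => y]
  have h0 := gammaTailMoment_pos (r - 1) 0 hx
  have h : ∫ t in Set.Ioi (0 : ℝ), 2 * τ * (x + t) * ((1 + t / x) ^ (r - 1) * Real.exp (-t)) =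
      2 * τ * x * gammaTailMoment (r - 1) 0 x + 2 * τ * gammaTailMoment (r - 1) 1 x := by
    simp only [gammaTailMoment]
    rw [← integral_const_mul, ← integral_const_mul, ← integral_add
      ((integrableOn_gammaTailMoment _ 0 x).const_mul _)
      ((integrableOn_gammaTailMoment _ 1 x).const_mul _)]
    exact integral_congr_ae (.of_forall fun t => by ring)
  rw [h, excessMean]
  field_simp

lemma integral_channelGain_sq_exceedLaw :
    ∫ v, channelGain v ^ 2 ∂(exceedLaw r τ (2 * τ * x)) = excessSecondMoment (r - 1) τ x := by
  rw [integral_exceedLaw hr hτ hx fun y => y ^ 2]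
  have h0 := gammaTailMoment_pos (r - 1) 0 hx
  have h : ∫ t in Set.Ioi (0 : ℝ),
      (2 * τ * (x + t)) ^ 2 * ((1 + t / x) ^ (r - 1) * Real.exp (-t)) =
      (2 * τ) ^ 2 * x ^ 2 * gammaTailMoment (r - 1) 0 x +
        (2 * τ) ^ 2 * (2 * x) * gammaTailMoment (r - 1) 1 x +
        (2 * τ) ^ 2 * gammaTailMoment (r - 1) 2 x := by
    have h01 : Integrable (fun t : ℝ =>
        (2 * τ : ℝ) ^ 2 * x ^ 2 * (t ^ 0 * ((1 + t / x) ^ (r - 1) * Real.exp (-t))) +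
        (2 * τ) ^ 2 * (2 * x) * (t ^ 1 * ((1 + t / x) ^ (r - 1) * Real.exp (-t))))
        (volume.restrict (Set.Ioi 0)) :=
      ((integrableOn_gammaTailMoment _ 0 x).const_mul _).add
      ((integrableOn_gammaTailMoment _ 1 x).const_mul _)
    simp only [gammaTailMoment]
    rw [← integral_const_mul, ← integral_const_mul, ← integral_const_mul, ← integral_add
      ((integrableOn_gammaTailMoment _ 0 x).const_mul _)
      ((integrableOn_gammaTailMoment _ 1 x).const_mul _),
      ← integral_add h01 ((integrableOn_gammaTailMoment _ 2 x).const_mul _)]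
    exact integral_congr_ae (.of_forall fun t => by ring)
  rw [h, excessSecondMoment]
  field_simp

lemma hasMean_exceedLaw_coord_mul (l : ℕ) (a b : Fin r) :
    HasMean (fun v : Fin r → ℂ => ((channelGain v ^ l : ℝ) : ℂ) * (conj (v a) * v b))
      (exceedLaw r τ (2 * τ * x)) (if a = b then
        (((∫ v, channelGain v ^ (l + 1) ∂(exceedLaw r τ (2 * τ * x))) / r : ℝ) : ℂ) else 0) := by
  set w : ℝ → ℝ := (Set.Ioi (2 * τ * x : ℝ)).indicator fun y => y ^ l with hw
  have hwv : ∀ v : Fin r → ℂ, w (channelGain v) * channelGain v =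
      (exceedSet r (2 * τ * x)).indicator (fun v => channelGain v ^ (l + 1)) v := by
    intro v
    have : w (channelGain v) =
      (exceedSet r (2 * τ * x)).indicator (fun v => channelGain v ^ l) v := rfl
    rw [this]
    simp only [Set.indicator]
    split_ifs <;> ring
  have hs := measurableSet_exceedSet r (2 * τ * x)
  have hi : Integrable (fun v => w (channelGain v) * channelGain v) (userLaw r τ) := by
    simp_rw [hwv]
    exact (integrable_channelGain_pow hr hτ (l + 1)).indicator hs
  have hwm : Measurable w := (measurable_id.pow_const l).indicator measurableSet_Ioi
  have h := hasMean_weighted_coord_mul hτ.ne' hwm hi a b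
  have hf : (fun v : Fin r → ℂ => (w (channelGain v) : ℂ) * (conj (v a) * v b)) =
      (exceedSet r (2 * τ * x)).indicator
        (fun v => ((channelGain v ^ l : ℝ) : ℂ) * (conj (v a) * v b)) := by
    ext v
    have : w (channelGain v) =
      (exceedSet r (2 * τ * x)).indicator (fun v => channelGain v ^ l) v := rfl
    rw [this]
    simp only [Set.indicator]
    split_ifs <;> simp
  rw [hf] at h
  have h2 := h.cond hs (measure_exceedSet_ne_zero hr hτ hx)
  refine h2.congr (fun _ => rfl) ?_
  split_ifs
  · have h3 : ∫ v, channelGain v ^ (l + 1) ∂(exceedLaw r τ (2 * τ * x)) =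
        ((userLaw r τ).real (exceedSet r (2 * τ * x)))⁻¹ *
          ∫ v, w (channelGain v) * channelGain v ∂(userLaw r τ) := by
      simp_rw [hwv]
      rw [integral_indicator hs, exceedLaw, ProbabilityTheory.cond, integral_smul_measure,
        ENNReal.toReal_inv, ← measureReal_def, smul_eq_mul]
    rw [h3, Complex.real_smul]
    push_cast
    ring
  · simp

/-- Writing the gain as 2τ(x + t) and c = x + 1/(2τP), the logarithm splits as log(1 + 2τPx) + log(1
+ t/c). The cubic bound of the second term is integrated against the tail weight. This keeps the
second moment of the excess, on which the case of one transmitter depends. -/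
lemma integral_log_exceedLaw_le {P : ℝ} (hP : 0 < P) :
    ∫ v, Real.log (1 + P * channelGain v) ∂(exceedLaw r τ (2 * τ * x)) ≤
      Real.log (1 + P * (2 * τ * x)) +
        (gammaTailMoment (r - 1) 1 x / (x + 1 / (2 * τ * P)) -
          gammaTailMoment (r - 1) 2 x / (2 * (x + 1 / (2 * τ * P)) ^ 2) +
          gammaTailMoment (r - 1) 3 x / (3 * (x + 1 / (2 * τ * P)) ^ 3)) /
            gammaTailMoment (r - 1) 0 x := by
  have hτ' : (0 : ℝ) < τ := hτ
  rw [integral_exceedLaw hr hτ hx fun y => Real.log (1 + P * y)]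
  set c := x + 1 / (2 * τ * P) with hc
  have hc0 : 0 < c := by positivity
  have h0 := gammaTailMoment_pos (r - 1) 0 hx
  set L := Real.log (1 + P * (2 * τ * x))
  rw [div_le_iff₀ h0, add_mul, div_mul_cancel₀ _ h0.ne']
  set W : ℝ → ℝ := fun t => (1 + t / x) ^ (r - 1) * Real.exp (-t) with hW
  have hI : ∀ l : ℕ, IntegrableOn (fun t => t ^ l * W t) (Set.Ioi 0) := fun l =>
    integrableOn_gammaTailMoment (r - 1) l x
  have hi01 : IntegrableOn (fun t => L * (t ^ 0 * W t) + 1 / c * (t ^ 1 * W t)) (Set.Ioi 0) :=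
    ((hI 0).const_mul _).add ((hI 1).const_mul _)
  have hi23 : IntegrableOn (fun t => 1 / (3 * c ^ 3) * (t ^ 3 * W t) -
      1 / (2 * c ^ 2) * (t ^ 2 * W t)) (Set.Ioi 0) :=
    ((hI 3).const_mul _).sub ((hI 2).const_mul _)
  have hrhs : L * gammaTailMoment (r - 1) 0 x + (gammaTailMoment (r - 1) 1 x / c -
      gammaTailMoment (r - 1) 2 x / (2 * c ^ 2) + gammaTailMoment (r - 1) 3 x / (3 * c ^ 3)) =
      ∫ t in Set.Ioi (0 : ℝ), ((L * (t ^ 0 * W t) + 1 / c * (t ^ 1 * W t)) +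
        (1 / (3 * c ^ 3) * (t ^ 3 * W t) - 1 / (2 * c ^ 2) * (t ^ 2 * W t))) := by
    rw [integral_add hi01 hi23, integral_add ((hI 0).const_mul _) ((hI 1).const_mul _),
      integral_sub ((hI 3).const_mul _) ((hI 2).const_mul _), integral_const_mul,
      integral_const_mul, integral_const_mul, integral_const_mul]
    simp only [gammaTailMoment, hW]
    ring
  rw [hrhs]
  refine integral_mono_of_nonneg ?_ (hi01.add hi23) ?_
  · filter_upwards [ae_restrict_mem measurableSet_Ioi] with t ht
    have ht : 0 < t := ht
    have : 0 ≤ P * (2 * τ * (x + t)) := by positivity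
    exact mul_nonneg (Real.log_nonneg (by linarith)) (by positivity)
  · filter_upwards [ae_restrict_mem measurableSet_Ioi] with t ht
    have ht : 0 < t := ht
    have hWt : 0 ≤ W t := by simp only [hW]; positivity
    have e1 : 1 + P * (2 * τ * (x + t)) = (1 + P * (2 * τ * x)) * (1 + t / c) := by
      rw [hc]; field_simp; ring
    have e2 := log_one_add_le_cubic (z := t / c) (by positivity)
    have e3 : Real.log (1 + P * (2 * τ * (x + t))) = L + Real.log (1 + t / c) := by
      rw [e1, Real.log_mul (by positivity) (by positivity)]
    calc Real.log (1 + P * (2 * τ * (x + t))) * W t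
        ≤ (L + (t / c - (t / c) ^ 2 / 2 + (t / c) ^ 3 / 3)) * W t := by
          rw [e3]; gcongr
      _ = _ := by field_simp; ring

end Exceed

/-! ### Mean rate of one transmitter for a fixed set of transmitters -/

/-- Jensen's inequality for the capacity function, with a bound of the argument. -/
lemma integral_log_one_add_le {Ω : Type*} [MeasurableSpace Ω] {μ : Measure Ω}
    [IsProbabilityMeasure μ] {f b : Ω → ℝ} (hf0 : ∀ ω, 0 ≤ f ω)
    (hfb : ∀ ω, f ω ≤ b ω) {m y P : ℝ} (hP : 0 < P) (hb : HasMean b μ m) (hmy : m ≤ y)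
    (hy : 0 ≤ y) : ∫ ω, Real.log (1 + P * f ω) ∂μ ≤ Real.log (1 + P * y) := by
  have hy' : 0 < 1 + P * y := by positivity
  have hbi : Integrable (fun ω => P / (1 + P * y) * (b ω - y)) μ :=
    (hb.1.sub (integrable_const y)).const_mul _
  calc ∫ ω, Real.log (1 + P * f ω) ∂μ
      ≤ ∫ ω, (Real.log (1 + P * y) + P / (1 + P * y) * (b ω - y)) ∂μ := by
        refine integral_mono_of_nonneg (.of_forall fun ω => ?_)
          ((integrable_const _).add hbi) (.of_forall fun ω => ?_)
        · have := mul_nonneg hP.le (hf0 ω)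
          exact Real.log_nonneg (by linarith)
        · have h1 : 0 < 1 + P * b ω := by
            have := mul_nonneg hP.le ((hf0 ω).trans (hfb ω))
            linarith
          have h0 : 0 < 1 + P * f ω := by
            have := mul_nonneg hP.le (hf0 ω)
            linarith
          -- The tangent line of the logarithm at 1 + Py; its mean needs only the mean of b.
          have h2 := Real.log_le_sub_one_of_pos (div_pos h1 hy')
          rw [Real.log_div h1.ne' hy'.ne'] at h2
          have h3 : Real.log (1 + P * f ω) ≤ Real.log (1 + P * b ω) :=
            Real.log_le_log h0 (by gcongr; exact hfb ω)
          have h4 : (1 + P * b ω) / (1 + P * y) - 1 = P / (1 + P * y) * (b ω - y) := by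
            field_simp; ring
          show Real.log (1 + P * f ω) ≤ _
          linarith
    _ = Real.log (1 + P * y) + P / (1 + P * y) * (m - y) := by
        rw [integral_add (integrable_const _) hbi, integral_const_mul,
          integral_sub hb.1 (integrable_const y), hb.2]
        simp
    _ ≤ Real.log (1 + P * y) := by
        have : P / (1 + P * y) * (m - y) ≤ 0 :=
          mul_nonpos_of_nonneg_of_nonpos (by positivity) (by linarith)
        linarith

/-- The denominator in the bound is at least (r+j)u² for every a ≥ 0, so the subtracted fraction is
at most (j-1)/(r+j). For j ≥ 2 nothing more about a is used. -/
lemma mmseBoundSNR_ge {r j : ℕ} (hr : 1 ≤ r) (hj : 1 ≤ j) {P u a : ℝ} (hP : 0 < P) (hu : 0 < u)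
    (ha : 0 ≤ a) : P * ((1 - (j - 1) / (r + j)) * u) ≤ mmseBoundSNR r j P u a := by
  have hr0 : (1 : ℝ) ≤ r := by exact_mod_cast hr
  have hj0 : (1 : ℝ) ≤ j := by exact_mod_cast hj
  have hD : (r + j) * u ^ 2 ≤ (r : ℝ) * ((1 + (j : ℝ) / r) * (u + a) ^ 2 + a * (a + 1) + u) := by
    have e : (r : ℝ) * ((1 + (j : ℝ) / r) * (u + a) ^ 2 + a * (a + 1) + u) =
        (r + j) * (u + a) ^ 2 + r * (a * (a + 1) + u) := by field_simp; ring
    rw [e]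
    have h1 : u ^ 2 ≤ (u + a) ^ 2 := by gcongr; linarith
    have h2 : 0 ≤ (r : ℝ) * (a * (a + 1) + u) := by positivity
    nlinarith
  have hu2 : 0 < (r + j) * u ^ 2 := by positivity
  have h1 : ((j : ℝ) - 1) * u ^ 2 /
      ((r : ℝ) * ((1 + (j : ℝ) / r) * (u + a) ^ 2 + a * (a + 1) + u)) ≤ (j - 1) / (r + j) := by
    calc _ ≤ ((j : ℝ) - 1) * u ^ 2 / ((r + j) * u ^ 2) :=
          div_le_div_of_nonneg_left (mul_nonneg (by linarith) (sq_nonneg u)) hu2 hD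
      _ = _ := by field_simp
  have h2 : ((j : ℝ) - 1) / (r + j) ≤ 1 := by rw [div_le_one (by linarith)]; linarith
  unfold mmseBoundSNR
  rw [mul_assoc]
  refine mul_le_mul_of_nonneg_left ?_ hP.le
  exact mul_le_mul (by linarith) (by linarith) hu.le (by linarith)

lemma mmseBoundSNR_nonneg {r j : ℕ} (hr : 1 ≤ r) (hj : 1 ≤ j) {P u a : ℝ} (hP : 0 < P)
    (hu : 0 < u) (ha : 0 ≤ a) : 0 ≤ mmseBoundSNR r j P u a := by
  refine le_trans ?_ (mmseBoundSNR_ge hr hj hP hu ha)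
  have hr0 : (1 : ℝ) ≤ r := by exact_mod_cast hr
  have hj0 : (1 : ℝ) ≤ j := by exact_mod_cast hj
  have h2 : ((j : ℝ) - 1) / (r + j) ≤ 1 := by rw [div_le_one (by linarith)]; linarith
  exact mul_nonneg hP.le (mul_nonneg (by linarith) hu.le)

lemma isotropic_sinr_log_le {r K : ℕ} (hr : 1 ≤ r) {τ : ℝ≥0} (hτ : 0 < τ) {x P y t : ℝ}
    (hx : 0 < x) (hP : 0 < P) (hy : 0 ≤ y) (ν : Fin K → Measure (Fin r → ℂ))
    [∀ i, IsProbabilityMeasure (ν i)] {T : Finset (Fin K)} {i : Fin K} (hi : i ∈ T)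
    (hν : ∀ s ∈ T, ν s = exceedLaw r τ (2 * τ * x))
    (hyb : sinrMeanBound r T.card (excessMean (r - 1) τ x) (excessSecondMoment (r - 1) τ x) t ≤ y) :
    ∫ h, Real.log (1 + P * mmseSINR T h i) ∂(Measure.pi ν) ≤ Real.log (1 + P * y) := by
  have hr0 : (r : ℝ) ≠ 0 := by positivity
  have h₁ : ∀ s ∈ T, ∀ a b, HasMean (fun v : Fin r → ℂ => conj (v a) * v b) (ν s)
      (if a = b then ((excessMean (r - 1) τ x / r : ℝ) : ℂ) else 0) := by
    intro s hs a b
    have h := hasMean_exceedLaw_coord_mul hr hτ hx 0 a b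
    simp only [zero_add, pow_one, integral_channelGain_exceedLaw hr hτ hx] at h
    rw [hν s hs]
    exact h.congr (fun v => by simp) rfl
  have h₂ : ∀ s ∈ T, ∀ a b, HasMean
      (fun v : Fin r → ℂ => (channelGain v : ℂ) * (conj (v a) * v b)) (ν s)
      (if a = b then ((excessSecondMoment (r - 1) τ x / r : ℝ) : ℂ) else 0) := by
    intro s hs a b
    have h := hasMean_exceedLaw_coord_mul hr hτ hx 1 a b
    simp only [pow_one, one_add_one_eq_two, integral_channelGain_sq_exceedLaw hr hτ hx] at h
    rw [hν s hs]
    exact h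
  have h := hasMean_sinr_bound hi h₁ h₂ t
  refine integral_log_one_add_le (fun h => mmseSINR_nonneg T h i)
    (fun h => mmseSINR_le T h i t) hP h (le_trans (le_of_eq ?_) hyb) hy
  unfold sinrMeanBound
  field_simp

/-- For high thresholds, the mean rate of each of at most `r` transmitting users is below the
corresponding term of the capacity bound, with room for the Poisson approximation. -/
lemma eventually_transmitter_rate_le {r : ℕ} (hr : 1 ≤ r) {P : ℝ} (hP : 0 < P) {τ : ℝ≥0}
    (hτ : 0 < τ) (hτ1 : τ ≤ 1) : ∀ᶠ x in atTop, ∀ a : ℝ, 0 ≤ a →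
      2 * (1 + (((r - 1 : ℕ) : ℝ) - 1 / 8) / x) ≤ a →
      ∀ (K : ℕ) (ν : Fin K → Measure (Fin r → ℂ)), (∀ i, IsProbabilityMeasure (ν i)) →
      ∀ (T : Finset (Fin K)) (i : Fin K), i ∈ T → T.card ≤ r →
      (∀ s ∈ T, ν s = exceedLaw r τ (2 * τ * x)) →
      ∫ h, Real.log (1 + P * mmseSINR T h i) ∂(Measure.pi ν) ≤
        Real.exp (-(T.card * regGammaQ r x)) *
          Real.log (1 + mmseBoundSNR r T.card P (2 * τ * x) a) := by
  have hτ' : (0 : ℝ) < τ := hτ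
  have hd : ∀ j ∈ Finset.Icc 2 r,
      (0 : ℝ) < 1 - (j - 1) * (r + j + 1) / (r + j) ^ 2 ∧
      1 - ((j : ℝ) - 1) * (r + j + 1) / (r + j) ^ 2 < 1 - (j - 1) / (r + j) := by
    intro j hj
    have hj2 : (2 : ℝ) ≤ j := by exact_mod_cast (Finset.mem_Icc.1 hj).1
    have hr0 : (1 : ℝ) ≤ r := by exact_mod_cast hr
    constructor
    · rw [sub_pos, div_lt_one (by positivity)]; nlinarith
    · have : ((j : ℝ) - 1) * (r + j + 1) / (r + j) ^ 2 - (j - 1) / (r + j) =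
          (j - 1) / (r + j) ^ 2 := by field_simp; ring
      have h2 : 0 < ((j : ℝ) - 1) / (r + j) ^ 2 := div_pos (by linarith) (by positivity)
      linarith
  have hmany := (Filter.eventually_all_finset (Finset.Icc 2 r)).2 fun j hj =>
    (eventually_sinrMeanBound_le (Finset.mem_Icc.1 hj).1 (Finset.mem_Icc.1 hj).2 hτ').and
      (eventually_log_le_exp_mul_log hr j hP hτ' (hd j hj).1 (hd j hj).2)
  filter_upwards [hmany, eventually_single_user_bound hr hP hτ' (by exact_mod_cast hτ1),
    eventually_gt_atTop 0] with x hx hx1 hx0 a ha0 ha K ν hprob T i hi hT hν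
  have hu : (0 : ℝ) < 2 * τ * x := by positivity
  have hcard : 1 ≤ T.card := Finset.card_pos.2 ⟨i, hi⟩
  rcases hcard.eq_or_lt with h1 | h2
  -- A single transmitter: the SINR is bounded by the gain, and the second-order comparison is taken
  -- at α = a/2.
  · have hα := hx1 (a / 2) (by linarith)
    have hlog := integral_log_exceedLaw_le hr hτ hx0 hP
    rw [← h1]
    have hsnr : mmseBoundSNR r 1 P (2 * τ * x) a = P * (2 * τ * x + 2 * (a / 2)) := by
      simp only [mmseBoundSNR, Nat.cast_one, sub_self, zero_mul, zero_div, sub_zero]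
      ring
    rw [hsnr, Nat.cast_one, one_mul]
    refine le_trans ?_ (hlog.trans hα)
    have hgi : Integrable (fun v : Fin r → ℂ => P * channelGain v) (ν i) := by
      have := integrable_channelGain_pow_exceedLaw hr hτ hx0 1
      simp only [pow_one] at this
      rw [hν i hi]
      exact this.const_mul P
    have hlm : Measurable fun v : Fin r → ℂ => Real.log (1 + P * channelGain v) :=
      Real.measurable_log.comp
        (continuous_const.add (continuous_const.mul continuous_channelGain)).measurable
    have hli : Integrable (fun v : Fin r → ℂ => Real.log (1 + P * channelGain v)) (ν i) := by
      refine hgi.mono' hlm.aestronglyMeasurable (.of_forall fun v => ?_)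
      have h0 : 0 ≤ P * channelGain v := mul_nonneg hP.le (channelGain_nonneg v)
      rw [Real.norm_of_nonneg (Real.log_nonneg (by linarith))]
      have := Real.log_le_sub_one_of_pos (x := 1 + P * channelGain v) (by linarith)
      linarith
    calc ∫ h, Real.log (1 + P * mmseSINR T h i) ∂(Measure.pi ν)
        ≤ ∫ h : Fin K → Fin r → ℂ, Real.log (1 + P * channelGain (h i)) ∂(Measure.pi ν) := by
          refine integral_mono_of_nonneg (.of_forall fun h => ?_)
            (integrable_comp_eval (μ := ν) (i := i) hli) (.of_forall fun h => ?_)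
          · have := mul_nonneg hP.le (mmseSINR_nonneg T h i)
            exact Real.log_nonneg (by linarith)
          · have := mul_nonneg hP.le (mmseSINR_nonneg T h i)
            refine Real.log_le_log (by linarith) ?_
            gcongr
            exact mmseSINR_le_channelGain T h i
      _ = ∫ v, Real.log (1 + P * channelGain v) ∂(exceedLaw r τ (2 * τ * x)) := by
          rw [← hν i hi]
          exact integral_comp_eval (μ := ν) (i := i) hlm.aestronglyMeasurable
  · have hj : T.card ∈ Finset.Icc 2 r := Finset.mem_Icc.2 ⟨h2, hT⟩
    obtain ⟨hm, hl⟩ := hx _ hj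
    refine (isotropic_sinr_log_le hr hτ hx0 hP (mul_nonneg (hd _ hj).1.le hu.le) ν hi hν hm).trans
      (hl.trans ?_)
    refine mul_le_mul_of_nonneg_left (Real.log_le_log ?_ ?_) (Real.exp_pos _).le
    · have := mul_pos ((hd _ hj).1.trans (hd _ hj).2) hu
      have := mul_pos hP this
      linarith
    · have := mmseBoundSNR_ge hr hcard hP hu ha0
      linarith

/-! ### Decomposition by the set of transmitters and Poisson comparison -/

lemma pi_restrict_eq_smul_pi_cond {ι Ω : Type*} [Fintype ι] [MeasurableSpace Ω] (μ : Measure Ω)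
    [IsProbabilityMeasure μ] (A : ι → Set Ω) (hA : ∀ i, μ (A i) ≠ 0) :
    (Measure.pi fun i => μ.restrict (A i)) =
      (∏ i, μ (A i)) • Measure.pi fun i => ProbabilityTheory.cond μ (A i) := by
  refine Measure.pi_eq fun t ht => ?_
  rw [Measure.smul_apply, Measure.pi_pi, smul_eq_mul, ← Finset.prod_mul_distrib]
  refine Finset.prod_congr rfl fun i _ => ?_
  rw [ProbabilityTheory.cond, Measure.smul_apply, smul_eq_mul, ← mul_assoc,
    ENNReal.mul_inv_cancel (hA i) (measure_ne_top _ _), one_mul]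

section Channel

variable {K r : ℕ}

/-- The conditions on the single users that make `T` the set of transmitters. -/
def userEvent (r : ℕ) (u : ℝ) (T : Finset (Fin K)) (i : Fin K) : Set (Fin r → ℂ) :=
  if i ∈ T then exceedSet r u else (exceedSet r u)ᶜ

lemma measurableSet_userEvent (u : ℝ) (T : Finset (Fin K)) (i : Fin K) :
    MeasurableSet (userEvent r u T i) := by
  unfold userEvent
  split_ifs
  · exact measurableSet_exceedSet r u
  · exact (measurableSet_exceedSet r u).compl

lemma setOf_transmitters_eq (u : ℝ) (T : Finset (Fin K)) :
    {h : Fin K → Fin r → ℂ | transmitters u h = T} = Set.univ.pi (userEvent r u T) := by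
  ext h
  simp only [Set.mem_ofPred_eq, Set.mem_univ_pi, Finset.ext_iff]
  refine forall_congr' fun i => ?_
  unfold transmitters userEvent exceedSet
  by_cases hi : i ∈ T <;> simp [hi]

lemma measurableSet_transmitters_eq (u : ℝ) (T : Finset (Fin K)) :
    MeasurableSet {h : Fin K → Fin r → ℂ | transmitters u h = T} := by
  rw [setOf_transmitters_eq]
  exact MeasurableSet.univ_pi (measurableSet_userEvent u T)

/-- The sum capacity when `T` is the set of transmitters. -/
noncomputable def capacityOf (P : ℝ) (T : Finset (Fin K)) (h : Fin K → Fin r → ℂ) : ℝ :=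
  if T.card ≤ r then ∑ i ∈ T, Real.log (1 + P * mmseSINR T h i) else 0

lemma sumCapacity_eq_sum (P u : ℝ) (h : Fin K → Fin r → ℂ) : sumCapacity P u h =
    ∑ T : Finset (Fin K), {h | transmitters u h = T}.indicator (capacityOf P T) h := by
  rw [Finset.sum_eq_single (transmitters u h)]
  · simp [sumCapacity, capacityOf]
  · intro T _ hT
    exact Set.indicator_of_notMem (fun h' => hT h'.symm) _
  · simp

lemma log_one_add_mmseSINR_bounds {P : ℝ} (hP : 0 < P) (T : Finset (Fin K))
    (h : Fin K → Fin r → ℂ) (i : Fin K) : 0 ≤ Real.log (1 + P * mmseSINR T h i) ∧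
      Real.log (1 + P * mmseSINR T h i) ≤ P * channelGain (h i) := by
  have h0 := mul_nonneg hP.le (mmseSINR_nonneg T h i)
  have h1 := Real.log_le_sub_one_of_pos (x := 1 + P * mmseSINR T h i) (by linarith)
  have h2 := mul_le_mul_of_nonneg_left (mmseSINR_le_channelGain T h i) hP.le
  exact ⟨Real.log_nonneg (by linarith), by linarith⟩

variable {τ : ℝ≥0} {P : ℝ}

lemma integrable_capacityOf (hr : 1 ≤ r) (hτ : 0 < τ) (hP : 0 < P) (T : Finset (Fin K)) :
    Integrable (capacityOf (r := r) P T) (channelLaw K r τ) := by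
  have hg : ∀ i : Fin K, Integrable (fun h : Fin K → Fin r → ℂ => P * channelGain (h i))
      (channelLaw K r τ) := fun i => by
    have := integrable_channelGain_pow hr hτ 1
    simp only [pow_one] at this
    exact integrable_comp_eval (μ := fun _ : Fin K => userLaw r τ) (i := i) (this.const_mul P)
  unfold capacityOf
  split_ifs
  · refine integrable_finsetSum _ fun i _ => (hg i).mono' (Real.measurable_log.comp
      (((measurable_mmseSINR T i).const_mul P).const_add 1)).aestronglyMeasurable
      (.of_forall fun h => ?_)
    obtain ⟨h1, h2⟩ := log_one_add_mmseSINR_bounds hP T h i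
    rwa [Real.norm_of_nonneg h1]
  · exact integrable_zero _ _ _

lemma integrable_sumCapacity (hr : 1 ≤ r) (hτ : 0 < τ) (hP : 0 < P) (u : ℝ) :
    Integrable (sumCapacity (K := K) (r := r) P u) (channelLaw K r τ) := by
  rw [funext (sumCapacity_eq_sum P u)]
  exact integrable_finsetSum _ fun T _ =>
    (integrable_capacityOf hr hτ hP T).indicator (measurableSet_transmitters_eq u T)

lemma expectedSumCapacity_eq (hr : 1 ≤ r) (hτ : 0 < τ) (hP : 0 < P) (u : ℝ) :
    expectedSumCapacity K r τ P u = ∑ T : Finset (Fin K),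
      ∫ h in {h | transmitters u h = T}, capacityOf P T h ∂(channelLaw K r τ) := by
  unfold expectedSumCapacity
  rw [funext (sumCapacity_eq_sum P u), integral_finsetSum _ fun T _ =>
    (integrable_capacityOf hr hτ hP T).indicator (measurableSet_transmitters_eq u T)]
  exact Finset.sum_congr rfl fun T _ => integral_indicator (measurableSet_transmitters_eq u T)

lemma meanExceedances_eq (u : ℝ) :
    meanExceedances K r τ u = K * (userLaw r τ).real (exceedSet r u) := by
  unfold meanExceedances
  have hi : Integrable ((exceedSet r u).indicator fun _ => (1 : ℝ)) (userLaw r τ) :=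
    (integrable_const _).indicator (measurableSet_exceedSet r u)
  have h : ∀ h : Fin K → Fin r → ℂ, ((transmitters u h).card : ℝ) =
      ∑ i, (exceedSet r u).indicator (fun _ => (1 : ℝ)) (h i) := by
    intro h
    rw [transmitters, Finset.card_filter]
    push_cast
    rfl
  simp_rw [h]
  rw [channelLaw_eq, integral_finsetSum _ fun i _ =>
    integrable_comp_eval (μ := fun _ : Fin K => userLaw r τ) (i := i) hi]
  have h2 : ∀ i : Fin K, ∫ h : Fin K → Fin r → ℂ,
      (exceedSet r u).indicator (fun _ => (1 : ℝ)) (h i) ∂(Measure.pi fun _ => userLaw r τ) =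
      (userLaw r τ).real (exceedSet r u) := fun i => by
    rw [integral_comp_eval (μ := fun _ : Fin K => userLaw r τ) (i := i) hi.aestronglyMeasurable,
      integral_indicator (measurableSet_exceedSet r u)]
    simp
  simp [h2]

/-- That T is the set of transmitters is a product event, so conditioning on it keeps the users
independent. The strict bounds on p make every factor a genuine conditional law. -/
lemma setIntegral_transmitters_eq {u p : ℝ} (hp : (userLaw r τ).real (exceedSet r u) = p)
    (hp0 : 0 < p) (hp1 : p < 1) (T : Finset (Fin K)) (F : (Fin K → Fin r → ℂ) → ℝ) :
    (∀ i, IsProbabilityMeasure (ProbabilityTheory.cond (userLaw r τ) (userEvent r u T i))) ∧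
    ∫ h in {h | transmitters u h = T}, F h ∂(channelLaw K r τ) =
      p ^ T.card * (1 - p) ^ (K - T.card) *
        ∫ h, F h ∂(Measure.pi fun i =>
          ProbabilityTheory.cond (userLaw r τ) (userEvent r u T i)) := by
  have hreal : ∀ i, (userLaw r τ).real (userEvent r u T i) = if i ∈ T then p else 1 - p := by
    intro i
    unfold userEvent
    split_ifs
    · exact hp
    · rw [probReal_compl_eq_one_sub (measurableSet_exceedSet r u), hp]
  have hne : ∀ i, userLaw r τ (userEvent r u T i) ≠ 0 := by
    intro i h
    have h1 := hreal i
    rw [measureReal_def, h, ENNReal.toReal_zero] at h1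
    split_ifs at h1 <;> linarith
  refine ⟨fun i => cond_isProbabilityMeasure (hne i), ?_⟩
  rw [setOf_transmitters_eq, channelLaw_eq, Measure.restrict_pi_pi,
    pi_restrict_eq_smul_pi_cond _ _ hne, integral_smul_measure, smul_eq_mul, ENNReal.toReal_prod]
  congr 1
  simp only [← measureReal_def, hreal]
  rw [Finset.prod_ite, Finset.prod_const, Finset.prod_const]
  congr 2
  · simp
  · rw [Finset.filter_not, Finset.card_sdiff_of_subset (Finset.filter_subset _ _)]
    simp

/-- The binomial probabilities are at most the Poisson ones up to a factor `exp (j p)`. -/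
lemma choose_mul_pow_mul_exp_le {p : ℝ} (hp0 : 0 ≤ p) (hp1 : p ≤ 1) {j : ℕ} (hj : j ≤ K) :
    (K.choose j : ℝ) * (p ^ j * (1 - p) ^ (K - j)) * Real.exp (-(j * p)) ≤
      (K * p) ^ j * Real.exp (-(K * p)) / (j ! : ℝ) := by
  -- The exponent K - j instead of K is what costs the factor exp(jp).
  have h1 : (K.choose j : ℝ) ≤ (K : ℝ) ^ j / (j ! : ℝ) := Nat.choose_le_pow_div j K
  have h2 : (1 - p) ^ (K - j) ≤ Real.exp (-p) ^ (K - j) := by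
    refine pow_le_pow_left₀ (by linarith) ?_ _
    have := Real.add_one_le_exp (-p)
    linarith
  have h3 : Real.exp (-p) ^ (K - j) * Real.exp (-(j * p)) = Real.exp (-(K * p)) := by
    rw [← Real.exp_nat_mul, ← Real.exp_add, Nat.cast_sub hj]
    ring_nf
  calc (K.choose j : ℝ) * (p ^ j * (1 - p) ^ (K - j)) * Real.exp (-(j * p))
      ≤ (K : ℝ) ^ j / (j ! : ℝ) * (p ^ j * Real.exp (-p) ^ (K - j)) * Real.exp (-(j * p)) := by
        have : 0 ≤ (1 - p) ^ (K - j) := pow_nonneg (by linarith) _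
        gcongr
    _ = (K : ℝ) ^ j / (j ! : ℝ) * p ^ j * (Real.exp (-p) ^ (K - j) * Real.exp (-(j * p))) := by
        ring
    _ = _ := by rw [h3, mul_pow]; ring

end Channel

/-! ### The capacity bound -/

theorem mainTheorem5 (r : ℕ) (hr : 1 ≤ r) (P : ℝ) (hP : 0 < P)
    (τ : ℝ≥0) (hτ : 0 < τ) (hτ_le : τ ≤ 1) (κ : ℝ) :
    ∃ K₀ : ℕ, ∀ K : ℕ, K₀ ≤ K → ∀ k u : ℝ, 0 < k → k ≤ κ → meanExceedances K r τ u = k →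
      MeasureTheory.Integrable (sumCapacity (K := K) (r := r) P u) (channelLaw K r τ) ∧
      expectedSumCapacity K r τ P u ≤
        ∑ j ∈ Finset.Icc 1 r, k ^ j * Real.exp (-k) / (j ! : ℝ) *
          ((j : ℝ) * Real.log (1 + mmseBoundSNR r j P u (normConstA K r))) := by
  have hτ' : (0 : ℝ) < τ := hτ
  obtain ⟨X, hX⟩ := eventually_atTop.1
    ((eventually_transmitter_rate_le hr hP hτ hτ_le).and (eventually_gt_atTop 0))
  obtain ⟨Y, hY⟩ := eventually_atTop.1
    ((eventually_le_gammaTailMoment hr κ).and (eventually_gt_atTop 0))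
  have hX0 : 0 < X := (hX X le_rfl).2
  have hY0 : 0 < Y := (hY Y le_rfl).2
  have hlim : ∀ c : ℝ, Tendsto (fun K : ℕ => c / (K : ℝ)) atTop (𝓝 0) := fun c =>
    tendsto_const_nhds.div_atTop tendsto_natCast_atTop_atTop
  -- Since p ≤ κ/K, the conditions on κ/K force x > X and p < 1, uniformly in k; the one on 1/K
  -- forces the quantile q beyond Y.
  obtain ⟨K₀, hK₀⟩ := eventually_atTop.1 ((eventually_ge_atTop r).and
    (((hlim κ).eventually (eventually_lt_nhds (regGammaQ_pos hr hX0))).and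
    (((hlim κ).eventually (eventually_lt_nhds one_pos)).and
    ((hlim 1).eventually (eventually_lt_nhds (regGammaQ_pos hr hY0))))))
  refine ⟨K₀, fun K hK k u hk hkκ hmean => ⟨integrable_sumCapacity hr hτ hP u, ?_⟩⟩
  obtain ⟨hrK, hKX, hK1, hKY⟩ := hK₀ K hK
  have hK0 : (0 : ℝ) < K := by exact_mod_cast (hr.trans hrK)
  set p := (userLaw r τ).real (exceedSet r u) with hp
  rw [meanExceedances_eq, ← hp] at hmean
  have hpk : p = k / K := by rw [← hmean]; field_simp
  have hpκ : p ≤ κ / K := by rw [hpk]; gcongr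
  have hp0 : 0 < p := by rw [hpk]; positivity
  have hp1 : p < 1 := hpκ.trans_lt hK1
  have hu : 2 * τ * X < u := by
    by_contra! hcon
    have : regGammaQ r X ≤ p := by
      rw [← measureReal_exceedSet hr hτ hX0]
      exact measureReal_mono fun v hv => lt_of_le_of_lt hcon hv
    linarith
  obtain ⟨x, rfl⟩ : ∃ x, u = 2 * τ * x := ⟨u / (2 * τ), by field_simp⟩
  have hxX : X < x := lt_of_mul_lt_mul_left hu (by positivity)
  have hx0 : 0 < x := hX0.trans hxX
  have hpx : p = regGammaQ r x := measureReal_exceedSet hr hτ hx0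
  obtain ⟨hq0, hq⟩ := regGammaQInv_spec hr (y := 1 / (K : ℝ)) (by positivity)
    (by rw [div_le_one hK0]; exact_mod_cast hr.trans hrK)
  set q := regGammaQInv r (1 / (K : ℝ)) with hqdef
  have hYq : Y < q := by
    by_contra! hcon
    have := regGammaQ_anti hr hq0 hcon
    linarith
  have ha := normConstA_eq hr (hr.trans hrK) (hqdef ▸ hY0.trans hYq)
  rw [← hqdef] at ha
  have haI := (hY q hYq.le).1 x hx0 (by
    rw [← hpx, hq, hpk, mul_one_div]; gcongr)
  set a := normConstA K r
  have ha0 : 0 ≤ a := by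
    have := gammaTailMoment_pos (r - 1) 0 (hY0.trans hYq)
    rw [ha]; positivity
  have hrate := (hX x hxX.le).1 a ha0 (by rw [ha]; linarith) K
  set L : ℕ → ℝ := fun j => Real.log (1 + mmseBoundSNR r j P (2 * τ * x) a) with hL
  have hu0 : 0 < 2 * τ * x := by positivity
  have hL0 : ∀ j, 1 ≤ j → 0 ≤ L j := fun j hj => Real.log_nonneg (by
    have := mmseBoundSNR_nonneg hr hj hP hu0 ha0
    linarith)
  -- A bound for the contribution of one set of j transmitters; it depends on the set only through
  -- j, so the sets are then counted by size.
  let f : ℕ → ℝ := fun j => if j ≤ r then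
    p ^ j * (1 - p) ^ (K - j) * (j * (Real.exp (-(j * p)) * L j)) else 0
  have hT : ∀ T : Finset (Fin K),
      ∫ h in {h | transmitters (2 * τ * x) h = T}, capacityOf P T h ∂(channelLaw K r τ) ≤
        f T.card := by
    intro T
    simp only [capacityOf, f]
    split_ifs with hTr
    · obtain ⟨hprob, hint⟩ := setIntegral_transmitters_eq hp.symm hp0 hp1 T
        fun h => ∑ i ∈ T, Real.log (1 + P * mmseSINR T h i)
      rw [hint]
      have hpow : 0 ≤ (1 - p) ^ (K - T.card) := pow_nonneg (by linarith) _
      refine mul_le_mul_of_nonneg_left ?_ (by positivity)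
      have hν : ∀ s ∈ T, ProbabilityTheory.cond (userLaw r τ) (userEvent r (2 * τ * x) T s) =
          exceedLaw r τ (2 * τ * x) := fun s hs => by simp [userEvent, hs, exceedLaw]
      have hle : ∫ h, ∑ i ∈ T, Real.log (1 + P * mmseSINR T h i) ∂(Measure.pi fun i =>
          ProbabilityTheory.cond (userLaw r τ) (userEvent r (2 * τ * x) T i)) ≤
          ∑ i ∈ T, Real.exp (-(T.card * p)) * L T.card := by
        rw [integral_finsetSum]
        · refine Finset.sum_le_sum fun i hi => ?_
          rw [hpx]
          exact hrate _ hprob T i hi hTr hν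
        · intro i hi
          have hg : Integrable (fun v : Fin r → ℂ => P * channelGain v)
              (ProbabilityTheory.cond (userLaw r τ) (userEvent r (2 * τ * x) T i)) := by
            rw [hν i hi]
            have := integrable_channelGain_pow_exceedLaw hr hτ hx0 1
            simp only [pow_one] at this
            exact this.const_mul P
          refine (integrable_comp_eval (i := i) hg).mono' (Real.measurable_log.comp
            (((measurable_mmseSINR T i).const_mul P).const_add 1)).aestronglyMeasurable
            (.of_forall fun h => ?_)
          obtain ⟨h1, h2⟩ := log_one_add_mmseSINR_bounds hP T h i
          rwa [Real.norm_of_nonneg h1]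
      rwa [Finset.sum_const, nsmul_eq_mul] at hle
    · simp
  calc expectedSumCapacity K r τ P (2 * τ * x)
      ≤ ∑ T : Finset (Fin K), f T.card := by
        rw [expectedSumCapacity_eq hr hτ hP]
        exact Finset.sum_le_sum fun T _ => hT T
    _ = ∑ j ∈ Finset.range (K + 1), (K.choose j : ℝ) * f j := by
        have := Finset.sum_powerset_apply_card f (x := (Finset.univ : Finset (Fin K)))
        simpa using this
    _ = ∑ j ∈ Finset.Icc 1 r, (K.choose j : ℝ) * f j := by
        -- An idle slot drops out through the factor j, a collision through the definition of f; r ≤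
        -- K keeps the remaining sizes in range.
        refine (Finset.sum_subset (fun j hj => ?_) fun j _ hj => ?_).symm
        · rw [Finset.mem_Icc] at hj
          exact Finset.mem_range.2 (by omega)
        · rw [Finset.mem_Icc] at hj
          by_cases hjr : j ≤ r
          · obtain rfl : j = 0 := by omega
            simp [f]
          · simp [f, hjr]
    _ ≤ _ := by
        refine Finset.sum_le_sum fun j hj => ?_
        rw [Finset.mem_Icc] at hj
        have h := choose_mul_pow_mul_exp_le hp0.le hp1.le (hj.2.trans hrK)
        rw [hmean] at h
        simp only [f, if_pos hj.2]
        calc (K.choose j : ℝ) * (p ^ j * (1 - p) ^ (K - j) * (j * (Real.exp (-(j * p)) * L j)))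
            = (K.choose j : ℝ) * (p ^ j * (1 - p) ^ (K - j)) * Real.exp (-(j * p)) *
                (j * L j) := by ring
          _ ≤ _ := mul_le_mul_of_nonneg_right h (mul_nonneg (Nat.cast_nonneg j) (hL0 j hj.1))
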